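/- Let $B$ be a unital $C^*$-algebra with a state $\phi$ (a positive linear functional $\phi:B\to\mathbb C$ with $\phi(1)=1$). Write $B_{sa}$ for the selfadjoint part of $B$ with the norm metric, $\operatorname{Im}(b)=\frac1{2i}(b-b^*)$, and $\mathbb H^{\pm}(B)=\{b\in B:\exists\,\varepsilon>0,\ \pm\operatorname{Im}(b)\ge\varepsilon 1\}$. Let $\mathcal P_2(B)$ be the set of $2$-positive linear maps $\eta:B\to B$ (positive maps whose entrywise amplification to $M_2(B)$ is positive), with the metric induced by the operator norm $\|\eta\|=\sup_{\|b\|\le1}\|\eta(b)\|$. For probability measures $\mu,\nu$ on $\mathbb R$ with distribution functions $F_\mu,F_\nu$, let $$L(\mu,\nu)=\inf\{\varepsilon>0:\ F_\mu(t-\varepsilon)-\varepsilon\le F_\nu(t)\le F_\mu(t+\varepsilon)+\varepsilon\ \text{ for all } t\in\mathbb R\}$$ be the Lévy distance. For every $\eta\in\mathcal P_2(B)$ there is a unique function $G_\eta:\mathbb H^+(B)\to\mathbb H^-(B)$ with $$b\,G_\eta(b)=1+\eta(G_\eta(b))\,G_\eta(b)\qquad\text{for all } b\in\mathbb H^+(B),$$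 and for every $b_0\in B_{sa}$ there is a unique Borel probability measure $\mu_{(b_0,\eta)}$ on $\mathbb R$ (the density of states) with $$\phi\big(G_\eta(z1-b_0)\big)=\int_{\mathbb R}\frac{1}{z-t}\,d\mu_{(b_0,\eta)}(t)\qquad\text{for all } z\in\mathbb C \text{ with } \operatorname{Im} z>0.$$ Moreover: 1. With $c_1=3\left(\frac1\pi\right)^{1/3}<2.0484$, for all $\eta\in\mathcal P_2(B)$ and all $b_{0,0},b_{0,1}\in B_{sa}$, $$L(\mu_{(b_{0,1},\eta)},\mu_{(b_{0,0},\eta)})\le c_1\,\|b_{0,1}-b_{0,0}\|^{1/3}.$$ 2. With $c_2=5\left(\frac1{4\pi}\right)^{2/5}<1.8168$, for all $b_0\in B_{sa}$ and all $\eta_0,\eta_1\in\mathcal P_2(B)$, $$L(\mu_{(b_0,\eta_1)},\mu_{(b_0,\eta_0)})\le c_2\,\|\eta_1-\eta_0\|^{1/5}.$$ 3. Let $d$ be any product metric on $B_{sa}\times\mathcal P_2(B)$, that is, any metric which induces the product topology and with respect to which the two coordinate projections are uniformly continuous (for example any $\ell^p$-product metric, $1\le p\le\infty$). Then $(b_0,\eta)\mapsto\mu_{(b_0,\eta)}$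 is uniformly continuous from $(B_{sa}\times\mathcal P_2(B),d)$ to the probability measures on $\mathbb R$ with the metric $L$. -/

import Mathlib

open scoped ComplexOrder ComplexStarModule

namespace DysonDensity

section HalfPlanes

variable (B : Type*) [CStarAlgebra B] [PartialOrder B]

/-- The upper half-plane of `B`: all `b` with `Im b ≥ ε 1` for some `ε > 0`,
where `Im b = (b - b*) / (2i)`. -/
def upperHalf : Set B := {b | ∃ ε : ℝ, 0 < ε ∧ algebraMap ℝ B ε ≤ (ℑ b : B)}

/-- The lower half-plane of `B`: all `b` with `-Im b ≥ ε 1` for some `ε > 0`. -/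
def lowerHalf : Set B := {b | ∃ ε : ℝ, 0 < ε ∧ algebraMap ℝ B ε ≤ -(ℑ b : B)}

end HalfPlanes

section PositiveMaps

variable (B : Type*) [CStarAlgebra B] [PartialOrder B] [StarOrderedRing B]

/-- The set of all `k`-positive maps on `B`: those positive linear maps `η` for which
`(b i j) ↦ (η (b i j))` is positive on the C*-algebra of `k × k` matrices over `B`.
Positive linear maps are automatically bounded, so they are taken as a subset of the space
`B →L[ℂ] B`, which carries the operator norm. -/
def kPositiveMaps (k : ℕ) : Set (B →L[ℂ] B) :=
  {η | (∀ b : B, 0 ≤ b → 0 ≤ η b) ∧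
    ∀ M : CStarMatrix (Fin k) (Fin k) B, 0 ≤ M → 0 ≤ M.map η}

end PositiveMaps

section Dyson

variable {B : Type*} [CStarAlgebra B] [PartialOrder B]

instance : Nonempty (lowerHalf B) := by
  refine ⟨⟨-(Complex.I • (1 : B)), 1, one_pos, ?_⟩⟩
  simp [imaginaryPart_I_smul]

/-- For `z` in the complex upper half-plane and `b₀` selfadjoint, `z 1 - b₀` lies in the upper
half-plane of `B`. -/
theorem smul_one_sub_mem_upperHalf (z : UpperHalfPlane) (b₀ : selfAdjoint B) :
    (z : ℂ) • (1 : B) - (b₀ : B) ∈ upperHalf B := by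
  refine ⟨z.im, z.im_pos, ?_⟩
  have h : ℑ (b₀ : B) = 0 := b₀.2.imaginaryPart
  have h1 : ℜ (1 : B) = (1 : selfAdjoint B) := by
    ext; simp
  have h2 : ℑ (1 : B) = 0 := (IsSelfAdjoint.one B).imaginaryPart
  rw [map_sub, h, imaginaryPart_smul, h2, h1]
  simp [Algebra.algebraMap_eq_smul_one]

/-- `G : ℍ⁺(B) → ℍ⁻(B)` solves the Dyson equation `b G(b) = 1 + η(G(b)) G(b)`. -/
def IsDysonSolution (η : B →L[ℂ] B) (G : upperHalf B → lowerHalf B) : Prop :=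
  ∀ b : upperHalf B, (b : B) * (G b : B) = 1 + η (G b : B) * (G b : B)

/-- The function `G_η : ℍ⁺(B) → ℍ⁻(B)` that solves the Dyson equation. -/
noncomputable def dysonSolution (η : B →L[ℂ] B) : upperHalf B → lowerHalf B :=
  Classical.epsilon (IsDysonSolution η)

/-- `μ` is a probability measure on `ℝ` whose Cauchy transform is `z ↦ φ(G_η(z 1 - b₀))`. -/
def IsDensityOfStates (φ : B →ₚ[ℂ] ℂ) (b₀ : selfAdjoint B) (η : B →L[ℂ] B)
    (μ : MeasureTheory.ProbabilityMeasure ℝ) : Prop :=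
  ∀ z : UpperHalfPlane,
    φ (dysonSolution η ⟨(z : ℂ) • (1 : B) - (b₀ : B), smul_one_sub_mem_upperHalf z b₀⟩ : B) =
      ∫ t : ℝ, 1 / ((z : ℂ) - (t : ℂ)) ∂(μ : MeasureTheory.Measure ℝ)

/-- The density of states associated with the data pair `(b₀, η)`. -/
noncomputable def densityOfStates (φ : B →ₚ[ℂ] ℂ) (b₀ : selfAdjoint B) (η : B →L[ℂ] B) :
    MeasureTheory.ProbabilityMeasure ℝ :=
  Classical.epsilon (IsDensityOfStates φ b₀ η)

end Dyson

/-- The Lévy distance of two probability measures on the real line. -/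
noncomputable def levyDist (μ ν : MeasureTheory.ProbabilityMeasure ℝ) : ℝ :=
  sInf {ε : ℝ | 0 < ε ∧ ∀ t : ℝ,
    ProbabilityTheory.cdf (μ : MeasureTheory.Measure ℝ) (t - ε) - ε ≤
        ProbabilityTheory.cdf (ν : MeasureTheory.Measure ℝ) t ∧
      ProbabilityTheory.cdf (ν : MeasureTheory.Measure ℝ) t ≤
        ProbabilityTheory.cdf (μ : MeasureTheory.Measure ℝ) (t + ε) + ε}

/-- `d` is a metric on the product of the metric spaces `X` and `Y` which induces the product
topology and with respect to which the two coordinate projections are uniformly continuous.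
Among these are `max (dist x x') (dist y y')`, `dist x x' + dist y y'` and all other
`ℓᵖ`-product metrics. -/
structure IsProductMetric {X Y : Type*} [MetricSpace X] [MetricSpace Y]
    (d : X × Y → X × Y → ℝ) : Prop where
  eq_zero_iff : ∀ p q, d p q = 0 ↔ p = q
  symm : ∀ p q, d p q = d q p
  triangle : ∀ p q r, d p r ≤ d p q + d q r
  isOpen_iff : ∀ s : Set (X × Y), IsOpen s ↔ ∀ p ∈ s, ∃ ε > 0, ∀ q, d p q < ε → q ∈ s
  fst_unif : ∀ ε > 0, ∃ δ > 0, ∀ p q, d p q < δ → dist p.1 q.1 < ε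
  snd_unif : ∀ ε > 0, ∃ δ > 0, ∀ p q, d p q < δ → dist p.2 q.2 < ε

end DysonDensity

/-! Write G for the solution at b and d = b − η(G), so that G = d⁻¹ and −Im G = G (Im d) G* = G* (Im
d) G. Two solutions obey the resolvent identity G₁ − G₀ = G₁ (h + η(G₁ − G₀)) G₀, where h collects
the change of data. The difference is controlled not by its norm but by positivity of the 2 × 2
block with diagonal c·(−Im G₁), c·(−Im G₀) and off-diagonal entry G₁ − G₀. Such an inequality
survives one turn of the identity: η preserves it by 2-positivity, a bound ‖h‖ ≤ s adds s·1 to the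
diagonal, and conjugation by G₁ and G₀ turns multiples of Im d back into multiples of −Im G. Since
Im d ≥ η(−Im G) + κ, each turn pulls the constant towards s/κ, so every c > s/κ is admissible
(`posBlock_sub_of_fixedPoint`).

The same contraction with s = 0 gives uniqueness of G and geometric convergence of the iterates of w
↦ (b − η(w))⁻¹, locally uniformly in b. Hence z ↦ φ(G(z1 − b₀)) is holomorphic; it maps into the
closed lower half-plane and is asymptotic to 1/z, so Nevanlinna's theorem
(`exists_measure_of_asymptotic`) yields the density of states.

For the Hölder bounds, applying φ to the block gives |φ(G₁ − G₀)| ≤ (c/2)(−Im φ(G₁) − Im φ(G₀)). On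
the line Im z = y, −Im φ(G) is π times the density of μ convolved with the Cauchy law of scale y, so
the right side integrates to exactly πc: a pointwise bound becomes an L¹ bound with no loss. Undoing
the smoothing costs √(y/π) in Lévy distance for each measure, hence L ≤ 2e + c with y = πe². A
change of offset has c near ‖b₁ − b₀‖/y; a change of map has, after subdividing the segment from η₀
to η₁, total constant near ‖η₁ − η₀‖/y². Optimising over e produces the exponents 1/3 and 1/5 and
both constants. -/

namespace DysonDensity

/-! ### Positive 2 × 2 operator blocks. -/

section PosBlock

variable {B : Type*} [CStarAlgebra B] [PartialOrder B] [StarOrderedRing B]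

/-- The block matrix with rows `(a, x)` and `(x*, b)` is positive. -/
def PosBlock (a x b : B) : Prop :=
  0 ≤ (CStarMatrix.ofMatrix !![a, x; star x, b] : CStarMatrix (Fin 2) (Fin 2) B)

theorem posBlock_zero {a b : B} (ha : 0 ≤ a) (hb : 0 ≤ b) : PosBlock a 0 b := by
  obtain ⟨s, rfl⟩ := CStarAlgebra.nonneg_iff_eq_star_mul_self.mp ha
  obtain ⟨t, rfl⟩ := CStarAlgebra.nonneg_iff_eq_star_mul_self.mp hb
  refine (star_mul_self_nonneg (CStarMatrix.ofMatrix !![s, 0; 0, t])).trans_eq ?_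
  ext i j
  fin_cases i <;> fin_cases j <;>
    simp [CStarMatrix.mul_apply, Fin.sum_univ_two, CStarMatrix.star_apply]

theorem PosBlock.add {a x b a' x' b' : B} (h : PosBlock a x b) (h' : PosBlock a' x' b') :
    PosBlock (a + a') (x + x') (b + b') := by
  refine (add_nonneg h h').trans_eq ?_
  ext i j
  fin_cases i <;> fin_cases j <;> simp

theorem PosBlock.mono {a x b a' b' : B} (h : PosBlock a x b) (ha : a ≤ a') (hb : b ≤ b') :
    PosBlock a' x b' := by
  simpa using h.add (posBlock_zero (sub_nonneg.mpr ha) (sub_nonneg.mpr hb))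

/-- Conjugation by the diagonal matrix diag(g*, h). The two corners may be multiplied by different
elements, which is what the resolvent identity with factors G₁ on the left and G₀ on the right
requires. -/
theorem PosBlock.conj {a x b : B} (H : PosBlock a x b) (g h : B) :
    PosBlock (g * a * star g) (g * x * h) (star h * b * h) := by
  refine (star_left_conjugate_nonneg H
    (CStarMatrix.ofMatrix !![star g, 0; 0, h])).trans_eq ?_
  ext i j
  fin_cases i <;> fin_cases j <;>
    simp [CStarMatrix.mul_apply, Fin.sum_univ_two, CStarMatrix.star_apply, mul_assoc]

theorem PosBlock.map {η : B →L[ℂ] B} (hη : η ∈ kPositiveMaps B 2)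
    (hs : ∀ x, η (star x) = star (η x)) {a x b : B} (h : PosBlock a x b) :
    PosBlock (η a) (η x) (η b) := by
  refine (hη.2 _ h).trans_eq ?_
  ext i j
  fin_cases i <;> fin_cases j <;> simp [hs]

theorem diag_nonneg_of_nonneg {M : CStarMatrix (Fin 2) (Fin 2) B} (h : 0 ≤ M) (i : Fin 2) :
    0 ≤ M i i := by
  induction StarOrderedRing.nonneg_iff.mp h using AddSubmonoid.closure_induction with
  | mem M hM =>
    obtain ⟨N, rfl⟩ := hM
    change 0 ≤ (star N * N) i i
    rw [CStarMatrix.mul_apply]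
    exact Finset.sum_nonneg fun k _ => star_mul_self_nonneg (N k i)
  | zero => exact le_rfl
  | add M N hM hN h₁ h₂ =>
    exact add_nonneg (h₁ (StarOrderedRing.nonneg_iff.mpr hM))
      (h₂ (StarOrderedRing.nonneg_iff.mpr hN))

theorem PosBlock.quadratic {a x b : B} (h : PosBlock a x b) (p q : B) :
    0 ≤ star p * a * p + star p * x * q + star q * star x * p + star q * b * q := by
  have := diag_nonneg_of_nonneg (star_left_conjugate_nonneg h
    (CStarMatrix.ofMatrix !![p, 0; q, 0])) 0
  refine this.trans_eq ?_
  simp [CStarMatrix.mul_apply, Fin.sum_univ_two, CStarMatrix.star_apply, mul_assoc, add_mul]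
  abel

theorem PosBlock.norm_sq_le {x : B} {α β : ℝ} (hα : 0 < α) (hβ : 0 ≤ β)
    (h : PosBlock (α • (1 : B)) x (β • (1 : B))) : ‖x‖ ^ 2 ≤ α * β := by
  -- This choice of vector completes the square: after scaling by α the form becomes αβ·1 − x*x.
  have h1 := h.quadratic (-(α⁻¹ • x)) 1
  have h2 : star x * x ≤ algebraMap ℝ B (α * β) := by
    rw [← sub_nonneg]
    have h3 := smul_nonneg hα.le h1
    refine h3.trans_eq ?_
    simp only [star_neg, star_smul, star_trivial, star_one, smul_mul_assoc, mul_smul_comm,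
      mul_one, one_mul, neg_mul, mul_neg, neg_neg, smul_add, smul_neg, smul_smul,
      Algebra.algebraMap_eq_smul_one]
    have e' : α * α⁻¹ = 1 := mul_inv_cancel₀ hα.ne'
    simp only [e', mul_one, one_smul]
    abel
  have h4 := (CStarAlgebra.norm_le_iff_le_algebraMap (star x * x) (by positivity)
    (star_mul_self_nonneg x)).mpr h2
  rwa [CStarRing.norm_star_mul_self, ← sq] at h4

theorem PosBlock.norm_le {x : B} {α : ℝ} (hα : 0 < α)
    (h : PosBlock (α • (1 : B)) x (α • (1 : B))) : ‖x‖ ≤ α := by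
  have := h.norm_sq_le hα hα.le
  nlinarith [norm_nonneg x]

/-- For s > 0 the block is s⁻¹ times the Gram matrix of the row (s, x), plus the diagonal remainder
s − s⁻¹x*x ≥ 0 in the lower corner. -/
theorem posBlock_of_norm_le {x : B} {s : ℝ} (hs : ‖x‖ ≤ s) :
    PosBlock (s • (1 : B)) x (s • (1 : B)) := by
  rcases (norm_nonneg x).trans hs |>.eq_or_lt with h0 | h0
  · have : x = 0 := norm_le_zero_iff.mp (hs.trans h0.ge)
    subst this
    exact posBlock_zero (by simp [← h0]) (by simp [← h0])
  have h1 : star x * x ≤ (s ^ 2) • (1 : B) := by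
    refine CStarAlgebra.star_mul_le_algebraMap_norm_sq.trans ?_
    rw [← Algebra.algebraMap_eq_smul_one]
    exact algebraMap_mono B (by gcongr)
  have h2 : 0 ≤ s • (1 : B) - s⁻¹ • (star x * x) := by
    rw [sub_nonneg]
    refine (smul_le_smul_of_nonneg_left h1 (inv_nonneg.mpr h0.le)).trans_eq ?_
    rw [smul_smul]; congr 1; field_simp
  have h3 : PosBlock (s • (1 : B)) x (s⁻¹ • (star x * x)) := by
    have e : (0 : CStarMatrix (Fin 2) (Fin 2) B) ≤ s⁻¹ •
        (star (CStarMatrix.ofMatrix !![s • 1, x; 0, 0]) *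
          CStarMatrix.ofMatrix !![s • 1, x; 0, 0]) :=
      smul_nonneg (inv_nonneg.mpr h0.le) (star_mul_self_nonneg _)
    refine e.trans_eq ?_
    ext i j
    fin_cases i <;> fin_cases j <;>
      simp [CStarMatrix.mul_apply, Fin.sum_univ_two, CStarMatrix.star_apply, smul_smul, h0.ne']
  simpa using h3.mono le_rfl (sub_nonneg.mp h2)

/-- Testing the block on the vector (1, −u), with u the phase that makes uφ(x) = |φ(x)|, and
applying φ. The arithmetic mean on the right is what will later integrate to π times a constant. -/
theorem PosBlock.norm_apply_le {a x b : B} (h : PosBlock a x b) (φ : B →ₚ[ℂ] ℂ) :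
    ‖φ x‖ ≤ ((φ a).re + (φ b).re) / 2 := by
  obtain ⟨u, hu, hux⟩ : ∃ u : ℂ, ‖u‖ = 1 ∧ u * φ x = ‖φ x‖ := by
    rcases eq_or_ne (φ x) 0 with h0 | h0
    · exact ⟨1, by simp, by simp [h0]⟩
    · refine ⟨(‖φ x‖ : ℂ) / φ x, ?_, div_mul_cancel₀ _ h0⟩
      simp [h0]
  have h1 := h.quadratic 1 (-(u • 1))
  have h2 : 0 ≤ φ (a - u • x - star u • star x + b) := by
    refine map_nonneg φ (h1.trans_eq ?_)
    have : star u * u = 1 := by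
      have := Complex.conj_mul' u
      simpa [hu] using this
    simp only [star_neg, star_smul, star_one, smul_mul_assoc, mul_smul_comm,
      mul_one, one_mul, neg_mul, mul_neg, neg_neg, smul_neg, smul_smul, this,
      mul_comm u (star u), one_smul]
    abel
  rw [map_add, map_sub, map_sub, map_smul, map_smul, map_star, smul_eq_mul, smul_eq_mul,
    ← star_mul', hux] at h2
  have h3 := (Complex.le_def.mp h2).1
  simp at h3
  linarith

end PosBlock

/-! ### Elementary properties of k-positive maps. -/

section TwoPositive

variable {B : Type*} [CStarAlgebra B] [PartialOrder B] [StarOrderedRing B]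
  {k : ℕ} {η : B →L[ℂ] B}

theorem map_star_of_mem_kPositiveMaps (hη : η ∈ kPositiveMaps B k) (x : B) :
    η (star x) = star (η x) :=
  map_star (PositiveLinearMap.mk₀ (η : B →ₗ[ℂ] B) hη.1) x

theorem map_imaginaryPart_of_mem_kPositiveMaps (hη : η ∈ kPositiveMaps B k) (x : B) :
    η (ℑ x : B) = ℑ (η x) := by
  simp [imaginaryPart_apply_coe, map_star_of_mem_kPositiveMaps hη]

theorem le_smul_one_of_norm_le {a : B} (ha : 0 ≤ a) {r : ℝ} (h : ‖a‖ ≤ r) : a ≤ r • (1 : B) := by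
  rw [← Algebra.algebraMap_eq_smul_one]
  exact (CStarAlgebra.norm_le_iff_le_algebraMap a ((norm_nonneg a).trans h) ha).mp h

theorem smul_one_mono {r s : ℝ} (h : r ≤ s) : r • (1 : B) ≤ s • (1 : B) :=
  smul_le_smul_of_nonneg_right h zero_le_one

theorem map_le_smul_one (hη : η ∈ kPositiveMaps B k) {a : B} (ha : 0 ≤ a) {r : ℝ}
    (h : ‖η‖ * ‖a‖ ≤ r) : η a ≤ r • (1 : B) :=
  le_smul_one_of_norm_le (hη.1 a ha) ((η.le_opNorm a).trans h)

/-- Allows two 2-positive maps to be joined by a segment along which the infinitesimal estimate is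
summed. -/
theorem convex_kPositiveMaps : Convex ℝ (kPositiveMaps B k) := by
  intro η hη ξ hξ s t hs ht _
  refine ⟨fun b hb => add_nonneg (smul_nonneg (α := ℝ) hs (hη.1 b hb)) (smul_nonneg (α := ℝ) ht (hξ.1 b hb)),
    fun M hM => ?_⟩
  refine (add_nonneg (smul_nonneg (α := ℝ) hs (hη.2 M hM)) (smul_nonneg (α := ℝ) ht (hξ.2 M hM))).trans_eq ?_
  ext i j
  simp

end TwoPositive

/-! ### Inverses of elements with strictly positive imaginary part. -/

section Resolvent

variable {B : Type*} [CStarAlgebra B]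

theorem sub_star_eq_imaginaryPart (d : B) : d - star d = (2 * Complex.I) • (ℑ d : B) := by
  rw [imaginaryPart_apply_coe, ← Complex.coe_smul, smul_smul, smul_smul]
  have : 2 * Complex.I * (-Complex.I) * ((2⁻¹ : ℝ) : ℂ) = 1 := by
    push_cast
    linear_combination (-1 : ℂ) * Complex.I_sq
  rw [mul_assoc, ← mul_assoc, this, one_smul]

theorem imaginaryPart_eq_of_sub_star {d k : B} (h : d - star d = (2 * Complex.I) • k) :
    (ℑ d : B) = k := by
  rw [sub_star_eq_imaginaryPart] at h
  exact (smul_right_injective B (by simp : (2 * Complex.I : ℂ) ≠ 0)) h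

/-- This form and its mirror image are both needed: `PosBlock.conj` puts g a g* in one corner and h*
b h in the other. -/
theorem neg_imaginaryPart_inverse_left {d : B} (hd : IsUnit d) :
    -(ℑ (Ring.inverse d) : B) = Ring.inverse d * (ℑ d : B) * star (Ring.inverse d) := by
  rw [neg_eq_iff_eq_neg]
  apply imaginaryPart_eq_of_sub_star
  have e1 : Ring.inverse d * d = 1 := Ring.inverse_mul_cancel d hd
  have e2 : star d * star (Ring.inverse d) = 1 := by rw [← star_mul, e1, star_one]
  calc Ring.inverse d - star (Ring.inverse d)
      = -(Ring.inverse d * (d - star d) * star (Ring.inverse d)) := by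
        rw [mul_sub, sub_mul, e1, one_mul, mul_assoc, e2, mul_one]; abel
    _ = _ := by
        rw [sub_star_eq_imaginaryPart, mul_smul_comm, smul_mul_assoc, smul_neg]

theorem neg_imaginaryPart_inverse_right {d : B} (hd : IsUnit d) :
    -(ℑ (Ring.inverse d) : B) = star (Ring.inverse d) * (ℑ d : B) * Ring.inverse d := by
  rw [neg_eq_iff_eq_neg]
  apply imaginaryPart_eq_of_sub_star
  have e1 : d * Ring.inverse d = 1 := Ring.mul_inverse_cancel d hd
  have e2 : star (Ring.inverse d) * star d = 1 := by rw [← star_mul, e1, star_one]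
  calc Ring.inverse d - star (Ring.inverse d)
      = -(star (Ring.inverse d) * (d - star d) * Ring.inverse d) := by
        rw [mul_sub, sub_mul, e2, one_mul, mul_assoc, e1, mul_one]; abel
    _ = _ := by
        rw [sub_star_eq_imaginaryPart, mul_smul_comm, smul_mul_assoc, smul_neg]

theorem inverse_sub_inverse {d₁ d₀ : B} (h₁ : IsUnit d₁) (h₀ : IsUnit d₀) :
    Ring.inverse d₁ - Ring.inverse d₀ = Ring.inverse d₁ * (d₀ - d₁) * Ring.inverse d₀ := by
  rw [mul_sub, sub_mul, Ring.inverse_mul_cancel d₁ h₁, one_mul, mul_assoc,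
    Ring.mul_inverse_cancel d₀ h₀, mul_one]

variable [PartialOrder B] [StarOrderedRing B]

/-- With s = (Im d)^{1/2} invertible, d = s (s⁻¹ (Re d) s⁻¹ + i) s, and the middle factor is
invertible because a selfadjoint element has real spectrum. -/
theorem isUnit_of_le_imaginaryPart {d : B} {ε : ℝ} (hε : 0 < ε)
    (h : ε • (1 : B) ≤ (ℑ d : B)) : IsUnit d := by
  have hK : IsStrictlyPositive (ℑ d : B) := by
    refine ⟨(smul_nonneg hε.le zero_le_one).trans h, ?_⟩
    refine CStarAlgebra.isUnit_of_le _ h ?_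
    refine ⟨smul_nonneg hε.le zero_le_one, ?_⟩
    rw [← Algebra.algebraMap_eq_smul_one]
    exact (IsUnit.mk0 ε hε.ne').map (algebraMap ℝ B)
  set s := CFC.sqrt (ℑ d : B) with hs
  have hss : s * s = (ℑ d : B) := CFC.sqrt_mul_sqrt_self _ hK.nonneg
  have hsa : star s = s := (CFC.sqrt_nonneg _).isSelfAdjoint
  have hsu : IsUnit s := by
    have : IsUnit (s * s) := hss ▸ hK.isUnit
    exact ((Commute.refl s).isUnit_mul_iff.mp this).1
  obtain ⟨u, hu⟩ := hsu
  set r : B := (↑u⁻¹ : B) with hr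
  have hra : star r = r := by
    have h1 : r * s = 1 := by rw [← hu]; simp [hr]
    have h2 : s * r = 1 := by rw [← hu]; simp [hr]
    have h3 : star r * s = 1 := by
      have := congrArg star h2
      rwa [star_mul, hsa, star_one] at this
    calc star r = star r * (s * r) := by rw [h2, mul_one]
      _ = r := by rw [← mul_assoc, h3, one_mul]
  have hA : IsSelfAdjoint (r * (ℜ d : B) * r) := by
    have := (ℜ d).2.conjugate r
    rwa [hra] at this
  have hv : IsUnit (r * (ℜ d : B) * r + Complex.I • (1 : B)) := by
    have : -Complex.I ∉ spectrum ℂ (r * (ℜ d : B) * r) := by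
      intro hm
      have := hA.mem_spectrum_eq_re hm
      simp at this
    rw [spectrum.notMem_iff, ← IsUnit.neg_iff] at this
    convert this using 1
    rw [Algebra.algebraMap_eq_smul_one]
    simp [add_comm]
  have hd : d = s * (r * (ℜ d : B) * r + Complex.I • (1 : B)) * s := by
    have h1 : r * s = 1 := by rw [← hu]; simp [hr]
    have h2 : s * r = 1 := by rw [← hu]; simp [hr]
    calc d = (ℜ d : B) + Complex.I • (ℑ d : B) := (realPart_add_I_smul_imaginaryPart d).symm
      _ = (s * r) * (ℜ d : B) * (r * s) + Complex.I • (s * s) := by rw [h1, h2, hss]; simp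
      _ = _ := by
        simp only [mul_add, add_mul, mul_smul_comm, smul_mul_assoc, mul_one, mul_assoc]
  rw [hd, ← hu]
  exact (u.isUnit.mul hv).mul u.isUnit

/-- From dd* ≤ (M² + 1)1 one gets d⁻¹(d⁻¹)* ≥ (M² + 1)⁻¹1, which is inserted into the formula for
−Im d⁻¹. The summand 1 keeps the denominator positive also in the zero algebra. -/
theorem le_neg_imaginaryPart_inverse {d : B} {ε : ℝ} (hε : 0 < ε)
    (h : ε • (1 : B) ≤ (ℑ d : B)) {M : ℝ} (hM : ‖d‖ ≤ M) :
    (ε / (M ^ 2 + 1)) • (1 : B) ≤ -(ℑ (Ring.inverse d) : B) := by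
  have hd := isUnit_of_le_imaginaryPart hε h
  have hp : 0 < M ^ 2 + 1 := by positivity
  have h1 : (1 : B) ≤ (M ^ 2 + 1) • (Ring.inverse d * star (Ring.inverse d)) := by
    have h2 : d * star d ≤ (M ^ 2 + 1) • (1 : B) := by
      refine CStarAlgebra.mul_star_le_algebraMap_norm_sq.trans ?_
      rw [Algebra.algebraMap_eq_smul_one]
      refine smul_one_mono ?_
      nlinarith [norm_nonneg d]
    have h3 := star_right_conjugate_le_conjugate h2 (Ring.inverse d)
    have e1 : Ring.inverse d * d = 1 := Ring.inverse_mul_cancel d hd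
    have e2 : star d * star (Ring.inverse d) = 1 := by rw [← star_mul, e1, star_one]
    rw [← mul_assoc, e1, one_mul, e2, mul_smul_comm, smul_mul_assoc, mul_one] at h3
    exact h3
  rw [neg_imaginaryPart_inverse_left hd]
  calc (ε / (M ^ 2 + 1)) • (1 : B)
      ≤ (ε / (M ^ 2 + 1)) • ((M ^ 2 + 1) • (Ring.inverse d * star (Ring.inverse d))) :=
        smul_le_smul_of_nonneg_left h1 (by positivity)
    _ = Ring.inverse d * (ε • (1 : B)) * star (Ring.inverse d) := by
        rw [smul_smul, div_mul_cancel₀ _ hp.ne', mul_smul_comm, smul_mul_assoc, mul_one]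
    _ ≤ _ := star_right_conjugate_le_conjugate h _

/-- With G = d⁻¹, ε GG* ≤ −Im G gives ε‖G‖² ≤ ‖G‖. -/
theorem norm_inverse_le {d : B} {ε : ℝ} (hε : 0 < ε)
    (h : ε • (1 : B) ≤ (ℑ d : B)) : ‖Ring.inverse d‖ ≤ 1 / ε := by
  have hd := isUnit_of_le_imaginaryPart hε h
  set G := Ring.inverse d with hG
  have h1 : ε • (G * star G) ≤ -(ℑ G : B) := by
    rw [neg_imaginaryPart_inverse_left hd, ← hG]
    have := star_right_conjugate_le_conjugate h G
    rwa [mul_smul_comm, smul_mul_assoc, mul_one] at this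
  have h2 := CStarAlgebra.norm_le_norm_of_nonneg_of_le
    (smul_nonneg hε.le (mul_star_self_nonneg G)) h1
  rw [norm_neg, norm_smul, CStarRing.norm_self_mul_star, Real.norm_of_nonneg hε.le] at h2
  have h3 : ‖(ℑ G : B)‖ ≤ ‖G‖ := imaginaryPart.norm_le G
  rw [le_div_iff₀ hε]
  by_contra! hc
  have : 0 < ‖G‖ := by
    by_contra! h0
    have : ‖G‖ = 0 := le_antisymm h0 (norm_nonneg _)
    rw [this] at hc; linarith
  nlinarith

end Resolvent

/-! ### The contraction argument for block inequalities. -/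

section Comparison

variable {B : Type*} [CStarAlgebra B] [PartialOrder B] [StarOrderedRing B]
  {η : B →L[ℂ] B}

/-- One step of the resolvent iteration contracts the constant of a positive block. -/
theorem PosBlock.resolvent_step (hη : η ∈ kPositiveMaps B 2) {d₁ d₀ : B} (h₁ : IsUnit d₁)
    (h₀ : IsUnit d₀) {a₁ a₀ x h : B} {s N N' : ℝ} (H : PosBlock (N • a₁) x (N • a₀))
    (hh : ‖h‖ ≤ s) (e₁ : s • (1 : B) + N • η a₁ ≤ N' • (ℑ d₁ : B))
    (e₀ : s • (1 : B) + N • η a₀ ≤ N' • (ℑ d₀ : B)) :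
    PosBlock (N' • -(ℑ (Ring.inverse d₁) : B))
      (Ring.inverse d₁ * (h + η x) * Ring.inverse d₀)
      (N' • -(ℑ (Ring.inverse d₀) : B)) := by
  have hm := H.map hη (map_star_of_mem_kPositiveMaps hη)
  rw [← Complex.coe_smul, ← Complex.coe_smul, map_smul, map_smul, Complex.coe_smul,
    Complex.coe_smul] at hm
  have := (((posBlock_of_norm_le hh).add hm).mono e₁ e₀).conj (Ring.inverse d₁) (Ring.inverse d₀)
  rw [neg_imaginaryPart_inverse_left h₁, neg_imaginaryPart_inverse_right h₀]
  simpa only [mul_smul_comm, smul_mul_assoc] using this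

/-- Supplies some finite constant from which the contraction can start. -/
theorem posBlock_of_le {a₁ a₀ x : B} {δ N : ℝ} (hδ : 0 < δ) (h₁ : δ • (1 : B) ≤ a₁)
    (h₀ : δ • (1 : B) ≤ a₀) (hN : ‖x‖ / δ ≤ N) : PosBlock (N • a₁) x (N • a₀) := by
  have hN0 : 0 ≤ N := (div_nonneg (norm_nonneg x) hδ.le).trans hN
  rw [div_le_iff₀ hδ] at hN
  refine (posBlock_of_norm_le hN).mono ?_ ?_ <;> rw [mul_smul] <;>
    exact smul_le_smul_of_nonneg_left ‹_› hN0

/-- Comparison of two fixed points of resolvent type. -/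
theorem posBlock_sub_of_fixedPoint (hη : η ∈ kPositiveMaps B 2) {d₁ d₀ h : B} {s κ : ℝ}
    (hκ : 0 < κ) (hh : ‖h‖ ≤ s)
    (hd : d₀ - d₁ = h + η (Ring.inverse d₁ - Ring.inverse d₀))
    (p₁ : κ • (1 : B) ≤ (ℑ d₁ : B)) (p₀ : κ • (1 : B) ≤ (ℑ d₀ : B))
    (h₁ : η (-(ℑ (Ring.inverse d₁) : B)) + κ • (1 : B) ≤ (ℑ d₁ : B))
    (h₀ : η (-(ℑ (Ring.inverse d₀) : B)) + κ • (1 : B) ≤ (ℑ d₀ : B))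
    {c : ℝ} (hc : s / κ < c) :
    PosBlock (c • -(ℑ (Ring.inverse d₁) : B)) (Ring.inverse d₁ - Ring.inverse d₀)
      (c • -(ℑ (Ring.inverse d₀) : B)) := by
  set G₁ := Ring.inverse d₁ with hG₁
  set G₀ := Ring.inverse d₀ with hG₀
  have u₁ := isUnit_of_le_imaginaryPart hκ p₁
  have u₀ := isUnit_of_le_imaginaryPart hκ p₀
  have hs : 0 ≤ s := (norm_nonneg h).trans hh
  obtain ⟨M, hM₁, hM₀, hMκ⟩ : ∃ M : ℝ, ‖(ℑ d₁ : B)‖ ≤ M ∧ ‖(ℑ d₀ : B)‖ ≤ M ∧ κ ≤ M :=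
    ⟨max (max ‖(ℑ d₁ : B)‖ ‖(ℑ d₀ : B)‖) κ, by simp, by simp, by simp⟩
  have hM : 0 < M := hκ.trans_le hMκ
  have n₁ : 0 ≤ (ℑ d₁ : B) := (smul_nonneg hκ.le zero_le_one).trans p₁
  have n₀ : 0 ≤ (ℑ d₀ : B) := (smul_nonneg hκ.le zero_le_one).trans p₀
  have a₁ := le_neg_imaginaryPart_inverse hκ p₁ (le_max_left ‖d₁‖ ‖d₀‖)
  have a₀ := le_neg_imaginaryPart_inverse hκ p₀ (le_max_right ‖d₁‖ ‖d₀‖)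
  set δ := κ / (max ‖d₁‖ ‖d₀‖ ^ 2 + 1)
  have hδ : 0 < δ := by positivity
  set r := 1 - κ / M
  have hr0 : 0 ≤ r := sub_nonneg.mpr ((div_le_one hM).mpr hMκ)
  have hr1 : r < 1 := sub_lt_self _ (by positivity)
  set N₀ := ‖G₁ - G₀‖ / δ
  have hN₀ : 0 ≤ N₀ := by positivity
  -- The excess t = rᵏN₀ over s/κ leaves slack κt·1 after s·1 has been absorbed. Since Im d ≤ M·1,
  -- this slack is at least (κt/M) Im d, so the excess shrinks by r = 1 − κ/M.
  have aux : ∀ (k : ℕ) (d a : B), η a + κ • (1 : B) ≤ (ℑ d : B) → ‖(ℑ d : B)‖ ≤ M →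
      0 ≤ (ℑ d : B) →
      s • (1 : B) + (s / κ + r ^ k * N₀) • η a ≤ (s / κ + r ^ (k + 1) * N₀) • (ℑ d : B) := by
    intro k d a h1 h2 h3
    have hrk : 0 ≤ r ^ k * N₀ := by positivity
    have hN : 0 ≤ s / κ + r ^ k * N₀ := by positivity
    have h4 : (ℑ d : B) ≤ M • (1 : B) := le_smul_one_of_norm_le h3 h2
    have h5 := smul_le_smul_of_nonneg_left h1 hN
    have h6 := smul_le_smul_of_nonneg_left h4 (show 0 ≤ κ / M * (r ^ k * N₀) by positivity)
    have h7 := add_le_add h5 h6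
    rw [← sub_nonneg] at h7 ⊢
    refine h7.trans_eq ?_
    rw [smul_add, smul_smul, smul_smul]
    have e1 : κ / M * (r ^ k * N₀) * M = κ * (r ^ k * N₀) := by field_simp
    have e2 : (s / κ + r ^ k * N₀) * κ = s + κ * (r ^ k * N₀) := by field_simp
    rw [e1, e2, pow_succ]
    have e3 : s / κ + r ^ k * r * N₀ = s / κ + r ^ k * N₀ - κ / M * (r ^ k * N₀) := by
      simp only [r]; ring
    rw [e3]
    module
  have key : ∀ k : ℕ, PosBlock ((s / κ + r ^ k * N₀) • -(ℑ G₁ : B)) (G₁ - G₀)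
      ((s / κ + r ^ k * N₀) • -(ℑ G₀ : B)) := by
    intro k
    induction k with
    | zero =>
      refine posBlock_of_le hδ a₁ a₀ ?_
      simp only [pow_zero, one_mul]
      exact le_add_of_nonneg_left (by positivity)
    | succ k ih =>
      have := ih.resolvent_step hη u₁ u₀ hh (aux k d₁ _ h₁ hM₁ n₁) (aux k d₀ _ h₀ hM₀ n₀)
      rwa [← hd, ← inverse_sub_inverse u₁ u₀] at this
  have hlim : Filter.Tendsto (fun k : ℕ => s / κ + r ^ k * N₀) Filter.atTop
      (nhds (s / κ + 0 * N₀)) :=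
    ((tendsto_pow_atTop_nhds_zero_of_lt_one hr0 hr1).mul_const _).const_add _
  rw [zero_mul, add_zero] at hlim
  -- Because c > s/κ is strict, finitely many turns suffice and no closedness of the positive cone
  -- is needed.
  obtain ⟨k, hk⟩ := (hlim.eventually (gt_mem_nhds hc)).exists
  have q₁ : 0 ≤ -(ℑ G₁ : B) := (smul_nonneg hδ.le zero_le_one).trans a₁
  have q₀ : 0 ≤ -(ℑ G₀ : B) := (smul_nonneg hδ.le zero_le_one).trans a₀
  exact (key k).mono (smul_le_smul_of_nonneg_right hk.le q₁)
    (smul_le_smul_of_nonneg_right hk.le q₀)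

end Comparison

/-! ### Existence and uniqueness for the Dyson equation by iteration. -/

section Existence

open Filter Topology

variable {B : Type*} [CStarAlgebra B]

theorem continuous_imaginaryPart_coe : Continuous fun x : B => (ℑ x : B) := by
  simp only [imaginaryPart_apply_coe]
  fun_prop

/-- The iterates of `w ↦ (b - η w)⁻¹` on the starting point `-i`. -/
noncomputable def dysonIterate (η : B →L[ℂ] B) (b : B) (k : ℕ) : B :=
  (fun w => Ring.inverse (b - η w))^[k] (-(Complex.I • (1 : B)))

theorem dysonIterate_succ (η : B →L[ℂ] B) (b : B) (k : ℕ) :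
    dysonIterate η b (k + 1) = Ring.inverse (b - η (dysonIterate η b k)) :=
  Function.iterate_succ_apply' _ _ _

theorem neg_imaginaryPart_neg_I_smul_one :
    -(ℑ (-(Complex.I • (1 : B))) : B) = 1 := by
  simp [imaginaryPart_I_smul]

variable [PartialOrder B] [StarOrderedRing B] {η : B →L[ℂ] B} {n : ℕ}

theorem imaginaryPart_sub_map (hη : η ∈ kPositiveMaps B n) (b w : B) :
    (ℑ (b - η w) : B) = ℑ b + η (-(ℑ w : B)) := by
  rw [map_neg, map_imaginaryPart_of_mem_kPositiveMaps hη, map_sub, AddSubgroupClass.coe_sub,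
    sub_eq_add_neg]

theorem map_add_le_imaginaryPart_sub (hη : η ∈ kPositiveMaps B n) {b w : B} {ε : ℝ}
    (hb : ε • (1 : B) ≤ (ℑ b : B)) :
    η (-(ℑ w : B)) + ε • (1 : B) ≤ (ℑ (b - η w) : B) := by
  rw [imaginaryPart_sub_map hη, add_comm]
  gcongr

theorem le_imaginaryPart_sub (hη : η ∈ kPositiveMaps B n) {b w : B} {ε : ℝ}
    (hb : ε • (1 : B) ≤ (ℑ b : B)) (hw : 0 ≤ -(ℑ w : B)) :
    ε • (1 : B) ≤ (ℑ (b - η w) : B) :=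
  (le_add_of_nonneg_left (hη.1 _ hw)).trans (map_add_le_imaginaryPart_sub hη hb)

theorem neg_imaginaryPart_inverse_nonneg {d : B} {ε : ℝ} (hε : 0 < ε)
    (h : ε • (1 : B) ≤ (ℑ d : B)) : 0 ≤ -(ℑ (Ring.inverse d) : B) :=
  (smul_nonneg (by positivity) zero_le_one).trans (le_neg_imaginaryPart_inverse hε h le_rfl)

theorem dysonIterate_bounds (hη : η ∈ kPositiveMaps B n) {b : B} {ε : ℝ} (hε : 0 < ε)
    (hb : ε • (1 : B) ≤ (ℑ b : B)) (k : ℕ) :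
    0 ≤ -(ℑ (dysonIterate η b k) : B) ∧ ‖dysonIterate η b k‖ ≤ max 1 (1 / ε) := by
  induction k with
  | zero =>
    constructor
    · simp only [dysonIterate, Function.iterate_zero, id]
      rw [neg_imaginaryPart_neg_I_smul_one]
      exact zero_le_one
    · refine le_max_of_le_left ?_
      simp only [dysonIterate, Function.iterate_zero, id, norm_neg, norm_smul, Complex.norm_I,
        one_mul]
      rcases subsingleton_or_nontrivial B with h | h
      · simp [Subsingleton.elim (1 : B) 0]
      · simp
  | succ k ih =>
    rw [dysonIterate_succ]
    have h := le_imaginaryPart_sub hη hb ih.1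
    exact ⟨neg_imaginaryPart_inverse_nonneg hε h, (norm_inverse_le hε h).trans (le_max_right _ _)⟩

/-- The block contraction applied to consecutive iterates, with no perturbation term. C and θ depend
on b only through ε and R; this uniformity is what later gives holomorphy in z. -/
theorem exists_dysonIterate_geometric (hη : η ∈ kPositiveMaps B 2) {ε : ℝ} (hε : 0 < ε)
    (R : ℝ) : ∃ C θ : ℝ, θ < 1 ∧ 0 ≤ θ ∧ ∀ b : B, ε • (1 : B) ≤ (ℑ b : B) → ‖b‖ ≤ R →
      ∀ k, dist (dysonIterate η b k) (dysonIterate η b (k + 1)) ≤ C * θ ^ k := by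
  set W := max 1 (1 / ε)
  have hW : 0 < W := zero_lt_one.trans_le (le_max_left _ _)
  set K := ‖η‖ * W + 1 with hK
  have hK0 : 0 < K := by positivity
  -- From η(−Im w) ≤ K·1 and Im d ≥ η(−Im w) + ε·1 it follows that η(−Im w) ≤ θ Im d for this θ,
  -- which is the contraction ratio.
  set θ := K / (K + ε) with hθ
  have hθ0 : 0 < θ := by positivity
  -- A common lower bound for −Im w₀ = 1 and for −Im w₁; together with ‖w₁ − w₀‖ ≤ 2W it determines
  -- the initial constant N.
  set δ := min 1 (ε / ((R + K) ^ 2 + 1))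
  have hδ : 0 < δ := by positivity
  set N := 2 * W / δ
  have hN : 0 < N := by positivity
  refine ⟨N * W, θ, by rw [hθ, div_lt_one (by positivity)]; linarith, hθ0.le,
    fun b hb hR k => ?_⟩
  set w := dysonIterate η b
  have hw := dysonIterate_bounds hη hε hb
  have hwK : ∀ k, ‖η (w k)‖ ≤ K := fun k =>
    (η.le_opNorm_of_le (hw k).2).trans (le_add_of_nonneg_right zero_le_one)
  have hu : ∀ k, ε • (1 : B) ≤ (ℑ (b - η (w k)) : B) := fun k =>
    le_imaginaryPart_sub hη hb (hw k).1
  have hd : ∀ k, IsUnit (b - η (w k)) := fun k => isUnit_of_le_imaginaryPart hε (hu k)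
  have hstep : ∀ (j k : ℕ), (0 : ℝ) • (1 : B) + (N * θ ^ j) • η (-(ℑ (w k) : B)) ≤
      (N * θ ^ (j + 1)) • (ℑ (b - η (w k)) : B) := by
    intro j k
    have h1 : η (-(ℑ (w k) : B)) ≤ K • (1 : B) := by
      refine map_le_smul_one hη (hw k).1 ?_
      rw [norm_neg]
      refine (mul_le_mul_of_nonneg_left ((imaginaryPart.norm_le _).trans (hw k).2)
        (norm_nonneg _)).trans ?_
      exact le_add_of_nonneg_right zero_le_one
    have h2 : η (-(ℑ (w k) : B)) ≤ θ • (ℑ (b - η (w k)) : B) := by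
      refine le_trans ?_ (smul_le_smul_of_nonneg_left (map_add_le_imaginaryPart_sub hη hb) hθ0.le)
      have h3 := smul_le_smul_of_nonneg_left h1 (show 0 ≤ ε / (K + ε) by positivity)
      rw [← sub_nonneg] at h3 ⊢
      refine h3.trans_eq ?_
      have e1 : ε / (K + ε) = 1 - θ := by rw [hθ]; field_simp; ring
      have e2 : (1 - θ) * K = θ * ε := by rw [hθ]; field_simp; ring
      rw [smul_smul, e1, e2]
      module
    rw [zero_smul, zero_add, pow_succ, ← mul_assoc, mul_smul (N * θ ^ j)]
    exact smul_le_smul_of_nonneg_left h2 (by positivity)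
  have key : ∀ k, PosBlock ((N * θ ^ k) • -(ℑ (w (k + 1)) : B)) (w (k + 1) - w k)
      ((N * θ ^ k) • -(ℑ (w k) : B)) := by
    intro k
    induction k with
    | zero =>
      refine posBlock_of_le hδ ?_ ?_ ?_
      · have hn : ‖b - η (w 0)‖ ≤ R + K :=
          (norm_sub_le _ _).trans (add_le_add hR (hwK 0))
        have := le_neg_imaginaryPart_inverse hε (hu 0) hn
        rw [← dysonIterate_succ] at this
        exact (smul_one_mono (min_le_right _ _)).trans this
      · have : -(ℑ (w 0) : B) = 1 := neg_imaginaryPart_neg_I_smul_one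
        rw [this]
        exact (smul_one_mono (min_le_left _ _)).trans_eq (one_smul _ _)
      · rw [pow_zero, mul_one]
        refine div_le_div_of_nonneg_right ?_ hδ.le
        have := norm_sub_le (w 1) (w 0)
        have h1 := (hw 0).2
        have h2 := (hw 1).2
        simp only [zero_add]
        linarith
    | succ k ih =>
      have := ih.resolvent_step hη (hd (k + 1)) (hd k) (h := 0) (s := 0) (by simp)
        (hstep k (k + 1)) (hstep k k)
      have e : 0 + η (w (k + 1) - w k) = (b - η (w k)) - (b - η (w (k + 1))) := by
        rw [map_sub]; abel
      rwa [e, ← inverse_sub_inverse (hd (k + 1)) (hd k), ← dysonIterate_succ,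
        ← dysonIterate_succ] at this
  have hle : ∀ k, (N * θ ^ (k : ℕ)) • -(ℑ (w k) : B) ≤ (N * W * θ ^ k) • (1 : B) ∧
      (N * θ ^ (k : ℕ)) • -(ℑ (w (k + 1)) : B) ≤ (N * W * θ ^ k) • (1 : B) := by
    intro k
    have e : N * W * θ ^ k = N * θ ^ k * W := by ring
    have hpos : 0 ≤ N * θ ^ k := by positivity
    rw [e, mul_smul (N * θ ^ k) W]
    constructor <;> refine smul_le_smul_of_nonneg_left ?_ hpos <;>
      refine le_smul_one_of_norm_le (hw _).1 ?_ <;> rw [norm_neg] <;>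
      exact (imaginaryPart.norm_le _).trans (hw _).2
  rw [dist_comm, dist_eq_norm]
  exact ((key k).mono (hle k).2 (hle k).1).norm_le (by positivity)

theorem exists_dysonIterate_limit (hη : η ∈ kPositiveMaps B 2) {b : B} {ε : ℝ} (hε : 0 < ε)
    (hb : ε • (1 : B) ≤ (ℑ b : B)) :
    ∃ g : B, Tendsto (dysonIterate η b) atTop (𝓝 g) ∧ 0 ≤ -(ℑ g : B) ∧
      g = Ring.inverse (b - η g) := by
  obtain ⟨C, θ, hθ, -, hC⟩ := exists_dysonIterate_geometric hη hε ‖b‖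
  obtain ⟨g, hg⟩ := cauchySeq_tendsto_of_complete
    (cauchySeq_of_le_geometric θ C hθ (hC b hb le_rfl))
  have h0 : 0 ≤ -(ℑ g : B) :=
    ge_of_tendsto' ((continuous_imaginaryPart_coe.neg.tendsto g).comp hg)
      fun k => (dysonIterate_bounds hη hε hb k).1
  refine ⟨g, hg, h0, ?_⟩
  obtain ⟨u, hu⟩ := isUnit_of_le_imaginaryPart hε (le_imaginaryPart_sub hη hb h0)
  have hc := NormedRing.inverse_continuousAt u
  rw [hu] at hc
  have h1 : Tendsto (fun k => b - η (dysonIterate η b k)) atTop (𝓝 (b - η g)) :=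
    ((η.continuous.tendsto g).comp hg).const_sub b
  refine tendsto_nhds_unique (hg.comp (tendsto_add_atTop_nat 1)) ?_
  refine (hc.tendsto.comp h1).congr fun k => ?_
  simp [dysonIterate_succ]

/-- For equal data s = 0, so every positive constant is admissible in the block inequality, and −Im
g ≤ (1/ε)1 turns this into ‖g₁ − g₀‖ ≤ c for all c > 0. -/
theorem dyson_fixedPoint_unique (hη : η ∈ kPositiveMaps B 2) {b g₁ g₀ : B} {ε : ℝ} (hε : 0 < ε)
    (hb : ε • (1 : B) ≤ (ℑ b : B)) (h₁ : 0 ≤ -(ℑ g₁ : B)) (h₀ : 0 ≤ -(ℑ g₀ : B))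
    (e₁ : g₁ = Ring.inverse (b - η g₁)) (e₀ : g₀ = Ring.inverse (b - η g₀)) : g₁ = g₀ := by
  have p₁ := le_imaginaryPart_sub hη hb h₁
  have p₀ := le_imaginaryPart_sub hη hb h₀
  have key := fun c => posBlock_sub_of_fixedPoint (c := c) hη (h := 0) (s := 0) hε (by simp)
    (d₁ := b - η g₁) (d₀ := b - η g₀)
    (by rw [← e₁, ← e₀, map_sub]; abel) p₁ p₀
    (by rw [← e₁]; exact map_add_le_imaginaryPart_sub hη hb)
    (by rw [← e₀]; exact map_add_le_imaginaryPart_sub hη hb)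
  simp only [← e₁, ← e₀, zero_div] at key
  rw [← sub_eq_zero, ← norm_le_zero_iff]
  refine le_of_forall_pos_le_add fun c hc => ?_
  have n₁ : ‖g₁‖ ≤ 1 / ε := by rw [e₁]; exact norm_inverse_le hε p₁
  have n₀ : ‖g₀‖ ≤ 1 / ε := by rw [e₀]; exact norm_inverse_le hε p₀
  have aux : ∀ g : B, 0 ≤ -(ℑ g : B) → ‖g‖ ≤ 1 / ε → (c * ε) • -(ℑ g : B) ≤ c • (1 : B) := by
    intro g h n
    have := smul_le_smul_of_nonneg_left (le_smul_one_of_norm_le h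
      ((norm_neg _).trans_le ((imaginaryPart.norm_le g).trans n))) (mul_pos hc hε).le
    rwa [smul_smul, mul_assoc, mul_one_div_cancel hε.ne', mul_one] at this
  rw [zero_add]
  exact ((key _ (mul_pos hc hε)).mono (aux _ h₁ n₁) (aux _ h₀ n₀)).norm_le hc

theorem neg_imaginaryPart_nonneg_of_mem_lowerHalf {g : B} (hg : g ∈ lowerHalf B) :
    0 ≤ -(ℑ g : B) := by
  obtain ⟨ε, hε, h⟩ := hg
  rw [Algebra.algebraMap_eq_smul_one] at h
  exact (smul_nonneg hε.le zero_le_one).trans h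

theorem isDysonSolution_iff (hη : η ∈ kPositiveMaps B n) {G : upperHalf B → lowerHalf B} :
    IsDysonSolution η G ↔ ∀ b, (G b : B) = Ring.inverse ((b : B) - η (G b)) := by
  refine forall_congr' fun b => ?_
  obtain ⟨ε, hε, hb⟩ := b.2
  rw [Algebra.algebraMap_eq_smul_one] at hb
  have hu := isUnit_of_le_imaginaryPart hε (le_imaginaryPart_sub hη hb
    (neg_imaginaryPart_nonneg_of_mem_lowerHalf (G b).2))
  rw [← sub_eq_iff_eq_add, ← sub_mul]
  constructor
  · intro h
    rw [← mul_one (Ring.inverse _), ← h, ← mul_assoc, Ring.inverse_mul_cancel _ hu, one_mul]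
  · intro h
    nth_rewrite 2 [h]
    exact Ring.mul_inverse_cancel _ hu

theorem existsUnique_isDysonSolution (hη : η ∈ kPositiveMaps B 2) :
    ∃! G : upperHalf B → lowerHalf B, IsDysonSolution η G := by
  have : ∀ b : upperHalf B, ∃ g : lowerHalf B, (g : B) = Ring.inverse ((b : B) - η g) := by
    rintro ⟨b, ε, hε, hb⟩
    rw [Algebra.algebraMap_eq_smul_one] at hb
    obtain ⟨g, -, hg, e⟩ := exists_dysonIterate_limit hη hε hb
    have hd := le_imaginaryPart_sub hη hb hg
    refine ⟨⟨g, ε / (‖b - η g‖ ^ 2 + 1), ?_, ?_⟩, e⟩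
    · positivity
    · rw [Algebra.algebraMap_eq_smul_one]
      have := le_neg_imaginaryPart_inverse hε hd le_rfl
      rwa [← e] at this
  choose G hG using this
  refine ⟨G, (isDysonSolution_iff hη).mpr hG, fun G' hG' => ?_⟩
  funext b
  obtain ⟨ε, hε, hb⟩ := b.2
  rw [Algebra.algebraMap_eq_smul_one] at hb
  exact Subtype.ext (dyson_fixedPoint_unique hη hε hb
    (neg_imaginaryPart_nonneg_of_mem_lowerHalf (G' b).2)
    (neg_imaginaryPart_nonneg_of_mem_lowerHalf (G b).2)
    ((isDysonSolution_iff hη).mp hG' b) (hG b))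

theorem dysonSolution_eq_inverse (hη : η ∈ kPositiveMaps B 2) (b : upperHalf B) :
    (dysonSolution η b : B) = Ring.inverse ((b : B) - η (dysonSolution η b)) :=
  (isDysonSolution_iff hη).mp
    (Classical.epsilon_spec (existsUnique_isDysonSolution hη).exists) b

theorem tendsto_dysonIterate (hη : η ∈ kPositiveMaps B 2) (b : upperHalf B) :
    Tendsto (dysonIterate η (b : B)) atTop (𝓝 (dysonSolution η b : B)) := by
  obtain ⟨ε, hε, hb⟩ := b.2
  rw [Algebra.algebraMap_eq_smul_one] at hb
  obtain ⟨g, hg, h0, e⟩ := exists_dysonIterate_limit hη hε hb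
  rwa [← dyson_fixedPoint_unique hη hε hb h0
    (neg_imaginaryPart_nonneg_of_mem_lowerHalf (dysonSolution η b).2) e
    (dysonSolution_eq_inverse hη b)]

end Existence

/-! ### The Poisson kernel on the line. -/

section PoissonKernel

open Filter Topology MeasureTheory Set

theorem hasDerivAt_arctan_div {y : ℝ} (hy : 0 < y) (t x : ℝ) :
    HasDerivAt (fun x => Real.arctan ((x - t) / y)) (y / ((x - t) ^ 2 + y ^ 2)) x := by
  have h := (((hasDerivAt_id x).sub_const t).div_const y).arctan
  convert! h using 1
  simp only [id]
  field_simp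
  ring

theorem integrable_poissonKernel {y : ℝ} (hy : 0 < y) (t : ℝ) :
    Integrable fun x : ℝ => y / ((x - t) ^ 2 + y ^ 2) := by
  have h := ((integrable_inv_one_add_sq.comp_div hy.ne').comp_sub_right t).const_mul y⁻¹
  refine h.congr (Eventually.of_forall fun x => ?_)
  simp only
  have : 0 < (x - t) ^ 2 + y ^ 2 := by positivity
  field_simp
  ring

theorem tendsto_arctan_div_atTop {y : ℝ} (hy : 0 < y) (t : ℝ) :
    Tendsto (fun x => Real.arctan ((x - t) / y)) atTop (𝓝 (Real.pi / 2)) :=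
  (Real.tendsto_arctan_atTop.mono_right nhdsWithin_le_nhds).comp
    ((tendsto_atTop_add_const_right _ (-t) tendsto_id).atTop_div_const hy)

theorem tendsto_arctan_div_atBot {y : ℝ} (hy : 0 < y) (t : ℝ) :
    Tendsto (fun x => Real.arctan ((x - t) / y)) atBot (𝓝 (-(Real.pi / 2))) :=
  (Real.tendsto_arctan_atBot.mono_right nhdsWithin_le_nhds).comp
    ((tendsto_atBot_add_const_right _ (-t) tendsto_id).atBot_div_const hy)

theorem integral_poissonKernel {y : ℝ} (hy : 0 < y) (t : ℝ) :
    ∫ x : ℝ, y / ((x - t) ^ 2 + y ^ 2) = Real.pi := by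
  rw [integral_of_hasDerivAt_of_tendsto (hasDerivAt_arctan_div hy t)
    (integrable_poissonKernel hy t) (tendsto_arctan_div_atBot hy t)
    (tendsto_arctan_div_atTop hy t)]
  ring

theorem integral_Iic_poissonKernel {y : ℝ} (hy : 0 < y) (t s : ℝ) :
    ∫ x in Iic s, y / ((x - t) ^ 2 + y ^ 2) = Real.arctan ((s - t) / y) + Real.pi / 2 := by
  rw [integral_Iic_of_hasDerivAt_of_tendsto' (fun x _ => hasDerivAt_arctan_div hy t x)
    (integrable_poissonKernel hy t).integrableOn (tendsto_arctan_div_atBot hy t)]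
  ring

theorem inv_im_eq (u v : ℝ) (t : ℝ) :
    (1 / ((⟨u, v⟩ : ℂ) - t)).im = -(v / ((u - t) ^ 2 + v ^ 2)) := by
  rw [one_div, Complex.inv_im]
  simp only [Complex.sub_im, Complex.ofReal_im, sub_zero, Complex.normSq_apply, Complex.sub_re,
    Complex.ofReal_re, neg_div, sq]

theorem integrable_of_norm_le_div_normSq {g : ℝ → ℂ} (hg : Continuous g) {C u v : ℝ} (hv : v ≠ 0)
    (h : ∀ x : ℝ, ‖g x‖ ≤ C / ((x - u) ^ 2 + v ^ 2)) : Integrable g := by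
  have h1 := (integrable_poissonKernel (abs_pos.mpr hv) u).const_mul (C / |v|)
  refine h1.mono' hg.aestronglyMeasurable (Eventually.of_forall fun x => (h x).trans_eq ?_)
  have := abs_pos.mpr hv
  rw [sq_abs]
  field_simp

end PoissonKernel

/-! ### Contour shifting in a half-plane. -/

section Contour

open Filter Topology MeasureTheory Set

/-- The integral along a horizontal line of a holomorphic function that decays quadratically in
the half-plane above it. -/
theorem integral_line_eq_zero {q : ℂ → ℂ} {y C R₀ : ℝ} (hy : 0 < y)
    (hd : ∀ ζ : ℂ, y ≤ ζ.im → DifferentiableAt ℂ q ζ)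
    (hq : ∀ ζ : ℂ, y ≤ ζ.im → R₀ ≤ ‖ζ‖ → ‖q ζ‖ ≤ C / ‖ζ‖ ^ 2)
    (hi : Integrable fun x : ℝ => q ⟨x, y⟩) : ∫ x : ℝ, q ⟨x, y⟩ = 0 := by
  have hmk : ∀ a b : ℝ, (a : ℂ) + b * Complex.I = ⟨a, b⟩ := fun a b => by
    apply Complex.ext <;> simp
  have hC : 0 ≤ C := by
    have h1 := hq ⟨R₀, max y |R₀|⟩ (le_max_left _ _)
      ((le_abs_self R₀).trans (Complex.abs_re_le_norm ⟨R₀, max y |R₀|⟩))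
    have h2 : 0 < ‖(⟨R₀, max y |R₀|⟩ : ℂ)‖ := by
      rw [norm_pos_iff]
      intro h
      have := congrArg Complex.im h
      simp only [Complex.zero_im] at this
      have := this ▸ le_max_left y |R₀|
      linarith
    have h3 := (norm_nonneg _).trans h1
    exact (div_nonneg_iff.mp h3).elim (fun h => h.1) fun h => absurd h.2 (not_le.mpr (by positivity))
  have hlim := intervalIntegral_tendsto_integral hi tendsto_neg_atTop_atBot tendsto_id
  -- Cauchy's theorem on the rectangle [−R, R] × [y, y + R]: the other three sides have total length
  -- 4R, and |q| ≤ C/R² on them.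
  refine tendsto_nhds_unique hlim (squeeze_zero_norm' (a := fun R : ℝ => 4 * C / R) ?_
    (tendsto_const_nhds.div_atTop tendsto_id))
  filter_upwards [eventually_ge_atTop (max R₀ 1)] with R hR
  have hR₀ : R₀ ≤ R := (le_max_left _ _).trans hR
  have hR0 : 0 < R := zero_lt_one.trans_le ((le_max_right _ _).trans hR)
  have hb : ∀ ζ : ℂ, y ≤ ζ.im → R ≤ ‖ζ‖ → ‖q ζ‖ ≤ C / R ^ 2 := fun ζ h1 h2 =>
    (hq ζ h1 (hR₀.trans h2)).trans (by gcongr)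
  have key := Complex.integral_boundary_rect_eq_zero_of_differentiableOn q ⟨-R, y⟩ ⟨R, y + R⟩
    fun ζ hζ => (hd ζ (by
      have := hζ.2
      simp only [mem_preimage, uIcc_of_le (show y ≤ y + R by linarith)] at this
      exact this.1)).differentiableWithinAt
  simp only [hmk] at key
  have b1 : ‖∫ x : ℝ in -R..R, q ⟨x, y + R⟩‖ ≤ C / R ^ 2 * |R - -R| := by
    refine intervalIntegral.norm_integral_le_of_norm_le_const fun x _ => hb _ (by simp [hR0.le]) ?_
    refine le_trans ?_ (Complex.abs_im_le_norm _)
    exact (by linarith : R ≤ y + R).trans (le_abs_self _)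
  have b2 : ∀ c : ℝ, |c| = R → ‖∫ t : ℝ in y..y + R, q ⟨c, t⟩‖ ≤ C / R ^ 2 * |y + R - y| := by
    intro c hc
    refine intervalIntegral.norm_integral_le_of_norm_le_const fun t ht => hb _ ?_ ?_
    · rw [uIoc_of_le (by linarith)] at ht
      exact ht.1.le
    · rw [← hc]
      exact Complex.abs_re_le_norm ⟨c, t⟩
  have b3 := b2 R (abs_of_pos hR0)
  have b4 := b2 (-R) (by rw [abs_neg, abs_of_pos hR0])
  have e1 : |R - -R| = 2 * R := by rw [abs_of_pos (by linarith)]; ring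
  have e2 : |y + R - y| = R := by rw [add_sub_cancel_left, abs_of_pos hR0]
  rw [e1] at b1
  rw [e2] at b3 b4
  have e3 : (∫ x : ℝ in -R..id R, q ⟨x, y⟩) = (∫ x : ℝ in -R..R, q ⟨x, y + R⟩) -
      Complex.I • (∫ t : ℝ in y..y + R, q ⟨R, t⟩) +
      Complex.I • (∫ t : ℝ in y..y + R, q ⟨-R, t⟩) := by
    rw [← sub_eq_zero, ← key, id]
    abel
  rw [e3]
  refine (norm_add_le _ _).trans ((add_le_add_left (norm_sub_le _ _) _).trans ?_)
  rw [norm_smul, norm_smul, Complex.norm_I, one_mul, one_mul]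
  have e4 : 4 * C / R = C / R ^ 2 * (2 * R) + C / R ^ 2 * R + C / R ^ 2 * R := by
    field_simp; ring
  rw [e4]
  linarith

end Contour

/-! ### Cauchy representation from a horizontal line. -/

section Nevanlinna

open Filter Topology MeasureTheory Set

theorem mk_ne_zero_of_im_ne {x y : ℝ} (hy : y ≠ 0) : (⟨x, y⟩ : ℂ) ≠ 0 := fun h =>
  hy (congrArg Complex.im h)

theorem normSq_mk (x y : ℝ) : ‖(⟨x, y⟩ : ℂ)‖ ^ 2 = x ^ 2 + y ^ 2 := by
  rw [Complex.sq_norm, Complex.normSq_mk]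
  ring

theorem continuous_line (y : ℝ) : Continuous fun x : ℝ => (⟨x, y⟩ : ℂ) := by
  have : (fun x : ℝ => (⟨x, y⟩ : ℂ)) = fun x : ℝ => (x : ℂ) + y * Complex.I := by
    funext x
    apply Complex.ext <;> simp
  rw [this]
  fun_prop

variable {f : ℂ → ℂ} {y C : ℝ}

theorem norm_le_of_asymptotic (hy : 0 < y)
    (hf : ∀ z : ℂ, y ≤ z.im → ‖z * f z - 1‖ ≤ C / ‖z‖) {z : ℂ} (hz : y ≤ z.im) :
    ‖f z‖ ≤ (1 + C / y) / ‖z‖ ∧ ‖f z - 1 / z‖ ≤ C / ‖z‖ ^ 2 := by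
  have hz0 : y ≤ ‖z‖ := hz.trans ((le_abs_self _).trans (Complex.abs_im_le_norm z))
  have hzp : 0 < ‖z‖ := hy.trans_le hz0
  have hzn : z ≠ 0 := norm_pos_iff.mp hzp
  have h := hf z hz
  have hC : 0 ≤ C := by
    have := (norm_nonneg _).trans h
    rwa [le_div_iff₀ hzp, zero_mul] at this
  constructor
  · rw [le_div_iff₀ hzp, mul_comm, ← norm_mul]
    calc ‖z * f z‖ = ‖(z * f z - 1) + 1‖ := by rw [sub_add_cancel]
      _ ≤ C / ‖z‖ + 1 := (norm_add_le _ _).trans (by rw [norm_one]; gcongr)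
      _ ≤ 1 + C / y := by rw [add_comm]; gcongr
  · have e : f z - 1 / z = (z * f z - 1) / z := by field_simp
    rw [e, norm_div, sq, ← div_div]
    gcongr

theorem continuous_comp_line (hy : 0 < y) (hd : ∀ z : ℂ, 0 < z.im → DifferentiableAt ℂ f z) :
    Continuous fun x : ℝ => f ⟨x, y⟩ :=
  continuous_iff_continuousAt.mpr fun x =>
    ContinuousAt.comp (f := fun x : ℝ => (⟨x, y⟩ : ℂ)) (g := f)
      (hd ⟨x, y⟩ hy).continuousAt (continuous_line y).continuousAt

/-- f − 1/z decays quadratically, so its line integral vanishes by contour shifting; the whole value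
comes from the Poisson kernel −Im(1/z). -/
theorem integral_im_line_eq_neg_pi (hy : 0 < y)
    (hd : ∀ z : ℂ, 0 < z.im → DifferentiableAt ℂ f z)
    (hf : ∀ z : ℂ, y ≤ z.im → ‖z * f z - 1‖ ≤ C / ‖z‖) :
    (Integrable fun x : ℝ => (f ⟨x, y⟩).im) ∧ ∫ x : ℝ, (f ⟨x, y⟩).im = -Real.pi := by
  have hcz : Continuous fun x : ℝ => 1 / (⟨x, y⟩ : ℂ) :=
    continuous_const.div (continuous_line y) fun x => mk_ne_zero_of_im_ne hy.ne'
  have hi : Integrable fun x : ℝ => f ⟨x, y⟩ - 1 / (⟨x, y⟩ : ℂ) := by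
    refine integrable_of_norm_le_div_normSq (C := C) (u := 0)
      ((continuous_comp_line hy hd).sub hcz) hy.ne' fun x => ?_
    rw [sub_zero, ← normSq_mk]
    exact (norm_le_of_asymptotic hy hf (z := ⟨x, y⟩) le_rfl).2
  have h0 : ∫ x : ℝ, (f ⟨x, y⟩ - 1 / (⟨x, y⟩ : ℂ)) = 0 :=
    integral_line_eq_zero (q := fun z => f z - 1 / z) (C := C) (R₀ := 0) hy
      (fun ζ h => (hd ζ (hy.trans_le h)).sub ((differentiableAt_const _).div differentiableAt_id
        fun h0 => by
          rw [h0, Complex.zero_im] at h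
          linarith))
      (fun ζ h _ => (norm_le_of_asymptotic hy hf h).2) hi
  have him : Integrable fun x : ℝ => (f ⟨x, y⟩ - 1 / (⟨x, y⟩ : ℂ)).im := hi.im
  have e : ∀ x : ℝ, (f ⟨x, y⟩).im =
      (f ⟨x, y⟩ - 1 / (⟨x, y⟩ : ℂ)).im - y / ((x - 0) ^ 2 + y ^ 2) := by
    intro x
    have := inv_im_eq x y 0
    rw [Complex.ofReal_zero, sub_zero] at this
    rw [Complex.sub_im, this]
    ring
  have h1 : ∫ x : ℝ, (f ⟨x, y⟩ - 1 / (⟨x, y⟩ : ℂ)).im = 0 := by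
    have := integral_im hi
    simp only [RCLike.im_to_complex] at this
    rw [this, h0, Complex.zero_im]
  simp only [e]
  refine ⟨him.sub (integrable_poissonKernel hy 0), ?_⟩
  rw [integral_sub him (integrable_poissonKernel hy 0), integral_poissonKernel hy,
    h1, zero_sub]

/-- The point z' is the reflection of z in the line Im = y. Cauchy's formula gives 2πi f(z) at z and
0 at z'. Conjugating the second integral gives it the same denominator as the first, and subtracting
leaves only Im f on the line. -/
theorem cauchy_representation_line (hy : 0 < y)
    (hd : ∀ z : ℂ, 0 < z.im → DifferentiableAt ℂ f z)
    (hf : ∀ z : ℂ, y ≤ z.im → ‖z * f z - 1‖ ≤ C / ‖z‖) {u v : ℝ} (hv : 0 < v) :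
    f ⟨u, v + y⟩ = ∫ x : ℝ, (-(f ⟨x, y⟩).im / Real.pi) • (1 / ((⟨u, v⟩ : ℂ) - x)) := by
  set w : ℂ := ⟨u, v⟩
  set z : ℂ := ⟨u, v + y⟩
  set z' : ℂ := ⟨u, y - v⟩
  set F := 1 + C / y
  have hcf := continuous_comp_line hy hd
  have hsub : ∀ x : ℝ, (⟨x, y⟩ : ℂ) - z = x - w := fun x => by
    apply Complex.ext <;> simp [z, w]
  have hsub' : ∀ x : ℝ, (⟨x, y⟩ : ℂ) - z' = x - star w := fun x => by
    apply Complex.ext <;> simp [z', w]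
  have hne : ∀ x : ℝ, (x : ℂ) - w ≠ 0 := fun x h => hv.ne' (by
    simpa [w] using congrArg Complex.im h)
  have hne' : ∀ x : ℝ, (x : ℂ) - star w ≠ 0 := fun x h => hv.ne' (by
    simpa [w] using congrArg Complex.im h)
  have hfar : ∀ ζ : ℂ, y ≤ ζ.im → v ≤ ‖ζ - z'‖ := fun ζ h => by
    refine le_trans ?_ ((le_abs_self _).trans (Complex.abs_im_le_norm _))
    simp [z']
    linarith
  have hfar0 : ∀ ζ : ℂ, y ≤ ζ.im → y ≤ ‖ζ‖ := fun ζ h =>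
    h.trans ((le_abs_self _).trans (Complex.abs_im_le_norm _))
  have hcomp : ∀ ζ : ℂ, y ≤ ζ.im → ‖ζ‖ ≤ (1 + ‖z'‖ / v) * ‖ζ - z'‖ := fun ζ h => by
    have h1 : ‖ζ‖ ≤ ‖ζ - z'‖ + ‖z'‖ := by simpa using norm_add_le (ζ - z') z'
    have h2 : ‖z'‖ ≤ ‖z'‖ / v * ‖ζ - z'‖ := by
      rw [div_mul_eq_mul_div, le_div_iff₀ hv]
      exact mul_le_mul_of_nonneg_left (hfar ζ h) (norm_nonneg _)
    linarith
  have hF : 0 ≤ F := by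
    have := (norm_nonneg _).trans (norm_le_of_asymptotic hy hf (z := ⟨0, y⟩) le_rfl).1
    have hp : 0 < ‖(⟨0, y⟩ : ℂ)‖ := norm_pos_iff.mpr (mk_ne_zero_of_im_ne hy.ne')
    rwa [le_div_iff₀ hp, zero_mul] at this
  have b₁ : ∀ ζ : ℂ, y ≤ ζ.im → ‖f ζ / (ζ - z')‖ ≤ (F * (1 + ‖z'‖ / v)) / ‖ζ‖ ^ 2 := by
    intro ζ h
    have h1 := (norm_le_of_asymptotic hy hf h).1
    have h2 := hcomp ζ h
    have h3 : 0 < ‖ζ‖ := hy.trans_le (hfar0 ζ h)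
    have h4 : 0 < ‖ζ - z'‖ := hv.trans_le (hfar ζ h)
    rw [norm_div, div_le_div_iff₀ h4 (by positivity)]
    rw [le_div_iff₀ h3] at h1
    calc ‖f ζ‖ * ‖ζ‖ ^ 2 = (‖f ζ‖ * ‖ζ‖) * ‖ζ‖ := by ring
      _ ≤ F * ((1 + ‖z'‖ / v) * ‖ζ - z'‖) := by gcongr
      _ = _ := by ring
  have i₁ : Integrable fun x : ℝ => f ⟨x, y⟩ / ((x : ℂ) - star w) := by
    refine integrable_of_norm_le_div_normSq (C := F * (1 + ‖z'‖ / v)) (u := 0)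
      (hcf.div (by fun_prop) hne') hy.ne' fun x => ?_
    rw [sub_zero, ← normSq_mk, ← hsub']
    exact b₁ ⟨x, y⟩ le_rfl
  have e₁ : ∫ x : ℝ, f ⟨x, y⟩ / ((x : ℂ) - star w) = 0 := by
    have := integral_line_eq_zero (q := fun ζ => f ζ / (ζ - z')) (R₀ := 0) hy
      (fun ζ h => (hd ζ (hy.trans_le h)).div (by fun_prop)
        (norm_pos_iff.mp (hv.trans_le (hfar ζ h)))) (fun ζ h _ => b₁ ζ h)
      (by simpa only [hsub'] using i₁)
    simpa only [hsub'] using this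
  have i₂ : Integrable fun x : ℝ => f ⟨x, y⟩ / ((x : ℂ) - w) := by
    refine i₁.norm.mono' (hcf.div (by fun_prop) hne).aestronglyMeasurable
      (Eventually.of_forall fun x => ?_)
    rw [norm_div, norm_div, ← norm_star ((x : ℂ) - w)]
    simp
  have hprod : ∀ x : ℝ, ((x : ℂ) - w) * ((x : ℂ) - star w) = ((x - u) ^ 2 + v ^ 2 : ℝ) := by
    intro x
    rw [sq, sq]
    apply Complex.ext <;> simp [w]
    ring
  have iK : Integrable fun x : ℝ => (z - z') / (((x : ℂ) - w) * ((x : ℂ) - star w)) := by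
    refine integrable_of_norm_le_div_normSq (C := ‖z - z'‖) (u := u) (v := v)
      (continuous_const.div (by fun_prop) fun x => mul_ne_zero (hne x) (hne' x)) hv.ne'
      fun x => ?_
    rw [hprod, norm_div, Complex.norm_real, Real.norm_of_nonneg (by positivity)]
  have eK : ∫ x : ℝ, (z - z') / (((x : ℂ) - w) * ((x : ℂ) - star w)) =
      2 * Real.pi * Complex.I := by
    have h1 : ∀ x : ℝ, (z - z') / (((x : ℂ) - w) * ((x : ℂ) - star w)) =
        (2 * Complex.I) * ((v / ((x - u) ^ 2 + v ^ 2) : ℝ) : ℂ) := by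
      intro x
      have h3 : z - z' = 2 * Complex.I * v := by
        apply Complex.ext <;> simp [z, z']; ring
      rw [hprod, h3, Complex.ofReal_div, mul_div_assoc]
    simp only [h1]
    rw [integral_const_mul, integral_complex_ofReal, integral_poissonKernel hv]
    ring
  have split : ∀ x : ℝ, f ⟨x, y⟩ * ((z - z') / (((x : ℂ) - w) * ((x : ℂ) - star w))) =
      f ⟨x, y⟩ / ((x : ℂ) - w) - f ⟨x, y⟩ / ((x : ℂ) - star w) := by
    intro x
    have h3 : z - z' = w - star w := by
      linear_combination hsub' x - hsub x
    rw [h3]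
    have := hne x
    have := hne' x
    field_simp
    ring
  -- Cauchy's formula at `z`
  have e₂ : ∫ x : ℝ, f ⟨x, y⟩ / ((x : ℂ) - w) = f z * (2 * Real.pi * Complex.I) := by
    -- `dslope` removes the pole at z but decays only like 1/ζ; the factor (z − z')/(ζ − z')
    -- supplies the missing power for the contour lemma. Its pole z' lies below the line.
    have hq : ∀ x : ℝ, dslope f z ⟨x, y⟩ * ((z - z') / ((⟨x, y⟩ : ℂ) - z')) =
        (f ⟨x, y⟩ / ((x : ℂ) - w) - f ⟨x, y⟩ / ((x : ℂ) - star w)) -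
        f z * ((z - z') / (((x : ℂ) - w) * ((x : ℂ) - star w))) := by
      intro x
      have hxz : (⟨x, y⟩ : ℂ) ≠ z := fun h => hne x (by rw [← hsub, h, sub_self])
      rw [← split, dslope_of_ne _ hxz, slope_def_field, hsub, hsub']
      have := hne x
      have := hne' x
      field_simp
    have i₁₂ : Integrable fun x : ℝ =>
        f ⟨x, y⟩ / ((x : ℂ) - w) - f ⟨x, y⟩ / ((x : ℂ) - star w) := i₂.sub i₁
    have h0 : ∫ x : ℝ, dslope f z ⟨x, y⟩ * ((z - z') / ((⟨x, y⟩ : ℂ) - z')) = 0 := by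
      refine integral_line_eq_zero (q := fun ζ => dslope f z ζ * ((z - z') / (ζ - z')))
        (C := 4 * F / y * ‖z - z'‖ * (1 + ‖z'‖ / v)) (R₀ := 2 * ‖z‖) hy ?_ ?_ ?_
      · intro ζ h
        have hs : {ζ : ℂ | 0 < ζ.im} ∈ 𝓝 z :=
          (isOpen_lt continuous_const Complex.continuous_im).mem_nhds (by
            change 0 < v + y; positivity)
        have hs' : {ζ : ℂ | 0 < ζ.im} ∈ 𝓝 ζ :=
          (isOpen_lt continuous_const Complex.continuous_im).mem_nhds (hy.trans_le h)
        have h1 : DifferentiableOn ℂ (dslope f z) {ζ : ℂ | 0 < ζ.im} :=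
          (Complex.differentiableOn_dslope hs).mpr fun a ha => (hd a ha).differentiableWithinAt
        exact (h1.differentiableAt hs').mul ((differentiableAt_const _).div (by fun_prop)
          (norm_pos_iff.mp (hv.trans_le (hfar ζ h))))
      · intro ζ h hR
        have h3 : 0 < ‖ζ‖ := hy.trans_le (hfar0 ζ h)
        have h4 : 0 < ‖ζ - z'‖ := hv.trans_le (hfar ζ h)
        have h5 : ‖ζ‖ ≤ 2 * ‖ζ - z‖ := by
          have : ‖ζ‖ ≤ ‖ζ - z‖ + ‖z‖ := by simpa using norm_add_le (ζ - z) z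
          linarith
        have h6 : 0 < ‖ζ - z‖ := by linarith
        have hζ : ζ ≠ z := fun h0 => by simp [h0] at h6
        have hz : y ≤ z.im := by simp [z, hv.le]
        have hb : ∀ a : ℂ, y ≤ a.im → ‖f a‖ ≤ F / y := fun a ha =>
          (norm_le_of_asymptotic hy hf ha).1.trans (by
            have := hfar0 a ha
            gcongr)
        have h7 : ‖f ζ - f z‖ ≤ 2 * F / y :=
          (norm_sub_le _ _).trans ((add_le_add (hb ζ h) (hb z hz)).trans_eq (by ring))
        have h8 := hcomp ζ h
        rw [dslope_of_ne _ hζ, slope_def_field, norm_mul, norm_div, norm_div,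
          div_mul_div_comm, div_le_div_iff₀ (by positivity) (by positivity)]
        calc ‖f ζ - f z‖ * ‖z - z'‖ * ‖ζ‖ ^ 2
            = ‖f ζ - f z‖ * ‖z - z'‖ * (‖ζ‖ * ‖ζ‖) := by ring
          _ ≤ 2 * F / y * ‖z - z'‖ * ((2 * ‖ζ - z‖) * ((1 + ‖z'‖ / v) * ‖ζ - z'‖)) := by
            gcongr
          _ = _ := by ring
      · simp only [hq]
        exact i₁₂.sub (iK.const_mul (f z))
    simp only [hq] at h0
    rw [integral_sub i₁₂ (iK.const_mul _), integral_sub i₂ i₁, e₁, sub_zero,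
      integral_const_mul, eK, sub_eq_zero] at h0
    exact h0
  have e₃ : ∫ x : ℝ, star (f ⟨x, y⟩ / ((x : ℂ) - star w)) = 0 := by
    have := integral_conj (μ := volume) (f := fun x : ℝ => f ⟨x, y⟩ / ((x : ℂ) - star w))
    rw [e₁, map_zero] at this
    exact this
  have i₄ : Integrable fun x : ℝ => star (f ⟨x, y⟩ / ((x : ℂ) - star w)) :=
    i₁.norm.mono' (continuous_star.comp (hcf.div (by fun_prop) hne')).aestronglyMeasurable
      (Eventually.of_forall fun x => (norm_star _).le)
  have hpt : ∀ x : ℝ, (-(f ⟨x, y⟩).im / Real.pi) • (1 / (w - x)) =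
      (2 * Real.pi * Complex.I)⁻¹ *
        (f ⟨x, y⟩ / ((x : ℂ) - w) - star (f ⟨x, y⟩ / ((x : ℂ) - star w))) := by
    intro x
    have h1 : star (f ⟨x, y⟩ / ((x : ℂ) - star w)) = star (f ⟨x, y⟩) / ((x : ℂ) - w) := by
      simp
    have h2 : f ⟨x, y⟩ - star (f ⟨x, y⟩) = (f ⟨x, y⟩).im * (2 * Complex.I) := by
      apply Complex.ext <;> simp; ring
    have h3 : w - x ≠ 0 := by
      rw [← neg_sub, neg_ne_zero]
      exact hne x
    have hpi : (Real.pi : ℂ) ≠ 0 := by exact_mod_cast Real.pi_ne_zero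
    rw [h1, ← sub_div, h2, Complex.real_smul, ← neg_sub w (x : ℂ)]
    push_cast
    have hI := Complex.I_ne_zero
    field_simp
  simp only [hpt]
  rw [integral_const_mul, integral_sub i₂ i₄, e₂, e₃, sub_zero]
  have hpi : (Real.pi : ℂ) ≠ 0 := by exact_mod_cast Real.pi_ne_zero
  have hI := Complex.I_ne_zero
  field_simp

end Nevanlinna

/-! ### Cauchy transforms and the limit onto the real line. -/

section CauchyTransform

open Filter Topology MeasureTheory Set

theorem sub_ofReal_ne_zero {z : ℂ} (hz : 0 < z.im) (t : ℝ) : z - t ≠ 0 := fun h => hz.ne' (by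
  simpa using congrArg Complex.im h)

theorem norm_one_div_sub_le {z : ℂ} (hz : 0 < z.im) (t : ℝ) : ‖1 / (z - (t : ℂ))‖ ≤ 1 / z.im := by
  rw [norm_div, norm_one]
  refine one_div_le_one_div_of_le hz ?_
  have := (le_abs_self _).trans (Complex.abs_im_le_norm (z - (t : ℂ)))
  simpa using this

theorem continuous_one_div_sub {z : ℂ} (hz : 0 < z.im) :
    Continuous fun t : ℝ => 1 / (z - (t : ℂ)) :=
  continuous_const.div (by fun_prop) (sub_ofReal_ne_zero hz)

theorem integrable_one_div_sub (μ : Measure ℝ) [IsFiniteMeasure μ] {z : ℂ} (hz : 0 < z.im) :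
    Integrable (fun t : ℝ => 1 / (z - (t : ℂ))) μ :=
  (integrable_const (1 / z.im)).mono' (continuous_one_div_sub hz).aestronglyMeasurable
    (Eventually.of_forall (norm_one_div_sub_le hz))

theorem im_integral_one_div_sub (μ : Measure ℝ) [IsFiniteMeasure μ] (x : ℝ) {y : ℝ} (hy : 0 < y) :
    (∫ t : ℝ, 1 / ((⟨x, y⟩ : ℂ) - (t : ℂ)) ∂μ).im =
      -∫ t : ℝ, y / ((x - t) ^ 2 + y ^ 2) ∂μ := by
  have h := integral_im (integrable_one_div_sub μ (z := ⟨x, y⟩) hy)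
  simp only [RCLike.im_to_complex, inv_im_eq] at h
  rw [← h, integral_neg]

variable {f : ℂ → ℂ}

theorem exists_measure_shift (hd : ∀ z : ℂ, 0 < z.im → DifferentiableAt ℂ f z)
    (him : ∀ z : ℂ, 0 < z.im → (f z).im ≤ 0) {y C : ℝ} (hy : 0 < y)
    (hf : ∀ z : ℂ, y ≤ z.im → ‖z * f z - 1‖ ≤ C / ‖z‖) :
    ∃ μ : ProbabilityMeasure ℝ, ∀ u v : ℝ, 0 < v →
      f ⟨u, v + y⟩ = ∫ t : ℝ, 1 / ((⟨u, v⟩ : ℂ) - (t : ℂ)) ∂(μ : Measure ℝ) := by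
  obtain ⟨hi, he⟩ := integral_im_line_eq_neg_pi hy hd hf
  have h0 : ∀ x : ℝ, 0 ≤ -(f ⟨x, y⟩).im / Real.pi := fun x =>
    div_nonneg (neg_nonneg.mpr (him ⟨x, y⟩ hy)) Real.pi_pos.le
  have hi' : Integrable fun x : ℝ => -(f ⟨x, y⟩).im / Real.pi := hi.neg.div_const _
  have hp : IsProbabilityMeasure
      (volume.withDensity fun x : ℝ => ENNReal.ofReal (-(f ⟨x, y⟩).im / Real.pi)) := by
    refine ⟨?_⟩
    rw [withDensity_apply _ MeasurableSet.univ, Measure.restrict_univ,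
      ← ofReal_integral_eq_lintegral_ofReal hi' (Eventually.of_forall h0),
      integral_div, integral_neg, he, neg_neg, div_self Real.pi_ne_zero, ENNReal.ofReal_one]
  refine ⟨⟨_, hp⟩, fun u v hv => ?_⟩
  have hm : Measurable fun x : ℝ => ENNReal.ofReal (-(f ⟨x, y⟩).im / Real.pi) :=
    (((Complex.continuous_im.comp (continuous_comp_line hy hd)).neg.div_const _).measurable).ennreal_ofReal
  rw [cauchy_representation_line hy hd hf hv]
  refine ((integral_withDensity_eq_integral_toReal_smul hm
    (Eventually.of_forall fun _ => ENNReal.ofReal_lt_top) _).trans ?_).symm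
  refine integral_congr_ae (Eventually.of_forall fun x => ?_)
  simp only [ENNReal.toReal_ofReal (h0 x)]

/-- Tightness read off the imaginary axis: v²/(t² + v²) ≤ 1 − ½·1_{|t| > v}, integrated against μ.
-/
theorem measure_compl_Icc_le (μ : Measure ℝ) [IsProbabilityMeasure μ] {v c : ℝ} (hv : 0 < v)
    (h : 1 - c ≤ -v * (∫ t : ℝ, 1 / ((⟨0, v⟩ : ℂ) - (t : ℂ)) ∂μ).im) :
    μ.real (Icc (-v) v)ᶜ ≤ 2 * c := by
  rw [im_integral_one_div_sub μ 0 hv, neg_mul_neg, ← integral_const_mul] at h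
  have hle : ∀ t : ℝ, v * (v / ((0 - t) ^ 2 + v ^ 2)) ≤
      1 - 1 / 2 * (Icc (-v) v)ᶜ.indicator (fun _ => (1 : ℝ)) t := by
    intro t
    by_cases ht : t ∈ (Icc (-v) v)ᶜ
    · rw [indicator_of_mem ht, ← mul_div_assoc, div_le_iff₀ (by positivity)]
      have : v ^ 2 ≤ t ^ 2 := by
        rw [mem_compl_iff, mem_Icc, ← abs_le, not_le] at ht
        exact sq_le_sq.mpr ((abs_of_pos hv).trans_le ht.le)
      nlinarith
    · rw [indicator_of_notMem ht, ← mul_div_assoc, div_le_iff₀ (by positivity)]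
      nlinarith [sq_nonneg t]
  have hi : Integrable (fun t : ℝ => v * (v / ((0 - t) ^ 2 + v ^ 2))) μ := by
    refine (integrable_const (1 : ℝ)).mono'
      (by fun_prop : Measurable _).aestronglyMeasurable (Eventually.of_forall fun t => ?_)
    rw [Real.norm_of_nonneg (by positivity), ← mul_div_assoc, div_le_one (by positivity)]
    nlinarith [sq_nonneg t]
  have hind : Integrable ((Icc (-v) v)ᶜ.indicator fun _ => (1 : ℝ)) μ :=
    (integrable_const _).indicator measurableSet_Icc.compl
  have hi' : Integrable (fun t : ℝ =>
      1 - 1 / 2 * (Icc (-v) v)ᶜ.indicator (fun _ => (1 : ℝ)) t) μ :=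
    (integrable_const (1 : ℝ)).sub (hind.const_mul (1 / 2))
  have := integral_mono hi hi' hle
  have e : ∫ t : ℝ, 1 / 2 * (Icc (-v) v)ᶜ.indicator (fun _ => (1 : ℝ)) t ∂μ =
      1 / 2 * μ.real (Icc (-v) v)ᶜ := by
    rw [integral_const_mul, integral_indicator_const _ measurableSet_Icc.compl, smul_eq_mul,
      mul_one]
  rw [integral_sub (integrable_const _) (hind.const_mul _), e, integral_const, probReal_univ,
    one_smul] at this
  linarith

/-- Nevanlinna's representation of holomorphic functions from the upper to the lower half-plane
that are asymptotic to `1 / z`. -/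
theorem exists_measure_of_asymptotic (hd : ∀ z : ℂ, 0 < z.im → DifferentiableAt ℂ f z)
    (him : ∀ z : ℂ, 0 < z.im → (f z).im ≤ 0)
    (hf : ∀ y : ℝ, 0 < y → ∃ C : ℝ, ∀ z : ℂ, y ≤ z.im → ‖z * f z - 1‖ ≤ C / ‖z‖) :
    ∃ μ : ProbabilityMeasure ℝ, ∀ z : ℂ, 0 < z.im →
      f z = ∫ t : ℝ, 1 / (z - (t : ℂ)) ∂(μ : Measure ℝ) := by
  have hex : ∀ n : ℕ, ∃ μ : ProbabilityMeasure ℝ, ∀ u v : ℝ, 0 < v →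
      f ⟨u, v + 1 / ((n : ℝ) + 1)⟩ =
        ∫ t : ℝ, 1 / ((⟨u, v⟩ : ℂ) - (t : ℂ)) ∂(μ : Measure ℝ) := fun n =>
    have hn : 0 < 1 / ((n : ℝ) + 1) := by positivity
    exists_measure_shift hd him hn (hf _ hn).choose_spec
  choose μ hμ using hex
  obtain ⟨C, hC⟩ := hf 1 one_pos
  have hC0 : 0 ≤ C := by
    have := (norm_nonneg _).trans (hC Complex.I (by simp))
    simpa using this
  -- The asymptotic constant at height 1 serves every n, because v + y ≥ 1 for all the points used.
  have htight : ∀ n k : ℕ, (μ n : Measure ℝ).real (Icc (-((k : ℝ) + 1)) ((k : ℝ) + 1))ᶜ ≤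
      2 * ((1 + C) / ((k : ℝ) + 1)) := by
    intro n k
    set v : ℝ := (k : ℝ) + 1
    have hv1 : 1 ≤ v := by simp [v]
    have hv : 0 < v := one_pos.trans_le hv1
    refine measure_compl_Icc_le (μ n : Measure ℝ) hv ?_
    rw [← hμ n 0 v hv]
    set y : ℝ := 1 / ((n : ℝ) + 1)
    have hy : 0 < y := by positivity
    have hy1 : y ≤ 1 := by
      rw [div_le_one (by positivity)]
      linarith [(Nat.cast_nonneg n : (0 : ℝ) ≤ n)]
    have h1 := (norm_le_of_asymptotic one_pos hC (z := ⟨0, v + y⟩)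
      (show 1 ≤ v + y by linarith)).2
    rw [normSq_mk] at h1
    have h2 := (abs_le.mp ((Complex.abs_im_le_norm _).trans h1)).2
    have h3 := inv_im_eq 0 (v + y) 0
    rw [Complex.ofReal_zero, sub_zero] at h3
    rw [Complex.sub_im, h3] at h2
    have e1 : (v + y) / ((0 - 0) ^ 2 + (v + y) ^ 2) = 1 / (v + y) := by
      field_simp
      ring
    rw [e1, sub_neg_eq_add, zero_pow two_ne_zero, zero_add] at h2
    have h4 : v * (1 / (v + y) - C / (v + y) ^ 2) ≤ -v * (f ⟨0, v + y⟩).im := by nlinarith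
    refine le_trans ?_ h4
    have h5 : C / (v + y) ^ 2 ≤ C / v ^ 2 := by gcongr; linarith
    have h6 : v * (1 / (v + y)) ≥ 1 - 1 / v := by
      rw [ge_iff_le, mul_one_div, sub_le_iff_le_add, div_add_div _ _ (by positivity) hv.ne',
        le_div_iff₀ (by positivity)]
      nlinarith
    have h7 : v * (C / v ^ 2) = C / v := by field_simp
    have h8 : v * (C / (v + y) ^ 2) ≤ C / v :=
      (mul_le_mul_of_nonneg_left h5 hv.le).trans_eq h7
    rw [add_div, mul_sub]
    linarith
  -- Prokhorov compactness; the limit is taken along an ultrafilter instead of a subsequence.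
  have hcomp := isCompact_setOfPred_probabilityMeasure_mass_eq_compl_isCompact_le (E := ℝ)
    (u := fun k : ℕ => Real.toNNReal (2 * ((1 + C) / ((k : ℝ) + 1))))
    (K := fun k : ℕ => Icc (-((k : ℝ) + 1)) ((k : ℝ) + 1))
    (by
      have h1 : Tendsto (fun k : ℕ => 2 * ((1 + C) / ((k : ℝ) + 1))) atTop (𝓝 (2 * 0)) :=
        (tendsto_const_nhds.div_atTop
          (tendsto_atTop_add_const_right _ _ tendsto_natCast_atTop_atTop)).const_mul 2
      rw [mul_zero] at h1
      have h2 := (continuous_real_toNNReal.tendsto 0).comp h1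
      rwa [Real.toNNReal_zero] at h2)
    (fun k => isCompact_Icc) (Or.inl inferInstance)
  obtain ⟨ν, -, hν⟩ := hcomp.ultrafilter_le_nhds ((hyperfilter ℕ).map μ) (by
    rw [le_principal_iff, Ultrafilter.coe_map, mem_map]
    refine Filter.univ_mem' fun n k => ?_
    rw [← NNReal.coe_le_coe, Real.coe_toNNReal _ (by positivity)]
    exact htight n k)
  have hν' : Tendsto μ (hyperfilter ℕ : Filter ℕ) (𝓝 ν) := hν
  refine ⟨ν, fun z hz => ?_⟩
  have h1 := (ProbabilityMeasure.tendsto_iff_forall_integral_rclike_tendsto ℂ).mp hν'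
    (BoundedContinuousFunction.ofNormedAddCommGroup (fun t : ℝ => 1 / (z - (t : ℂ)))
      (continuous_one_div_sub hz) (1 / z.im) (norm_one_div_sub_le hz))
  simp only [BoundedContinuousFunction.coe_ofNormedAddCommGroup] at h1
  refine tendsto_nhds_unique ?_ h1
  have h2 : Tendsto (fun n : ℕ => z + ((1 / ((n : ℝ) + 1) : ℝ) : ℂ) * Complex.I)
      (hyperfilter ℕ : Filter ℕ) (𝓝 (z + ((0 : ℝ) : ℂ) * Complex.I)) := by
    refine Tendsto.mono_left ?_ Nat.hyperfilter_le_atTop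
    exact (((Complex.continuous_ofReal.tendsto 0).comp
      tendsto_one_div_add_atTop_nhds_zero_nat).mul_const _).const_add z
  rw [Complex.ofReal_zero, zero_mul, add_zero] at h2
  refine ((hd z hz).continuousAt.tendsto.comp h2).congr fun n => ?_
  rw [Function.comp_apply, ← hμ n z.re z.im hz]
  generalize 1 / ((n : ℝ) + 1) = r
  congr 1
  apply Complex.ext <;> simp

end CauchyTransform

/-! ### Lévy distance and smoothing by the Cauchy law. -/

section Levy

open Filter Topology MeasureTheory Set ProbabilityTheory

theorem levyDist_le {μ ν : ProbabilityMeasure ℝ} {ε : ℝ} (hε : 0 < ε)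
    (h : ∀ t : ℝ, cdf (μ : Measure ℝ) (t - ε) - ε ≤ cdf (ν : Measure ℝ) t ∧
      cdf (ν : Measure ℝ) t ≤ cdf (μ : Measure ℝ) (t + ε) + ε) : levyDist μ ν ≤ ε :=
  csInf_le ⟨0, fun _ h => h.1.le⟩ ⟨hε, h⟩

theorem of_levyDist_lt {μ ν : ProbabilityMeasure ℝ} {ε : ℝ} (h : levyDist μ ν < ε) (t : ℝ) :
    cdf (μ : Measure ℝ) (t - ε) - ε ≤ cdf (ν : Measure ℝ) t ∧
      cdf (ν : Measure ℝ) t ≤ cdf (μ : Measure ℝ) (t + ε) + ε := by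
  obtain ⟨a, ⟨-, ha⟩, haε⟩ := exists_lt_of_csInf_lt (by
    refine ⟨1, one_pos, fun t => ⟨?_, ?_⟩⟩
    · linarith [cdf_le_one (μ : Measure ℝ) (t - 1), cdf_nonneg (ν : Measure ℝ) t]
    · linarith [cdf_nonneg (μ : Measure ℝ) (t + 1), cdf_le_one (ν : Measure ℝ) t]) h
  have h1 := monotone_cdf (μ : Measure ℝ) (show t - ε ≤ t - a by linarith)
  have h2 := monotone_cdf (μ : Measure ℝ) (show t + a ≤ t + ε by linarith)
  exact ⟨by linarith [(ha t).1], by linarith [(ha t).2]⟩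

theorem levyDist_nonneg (μ ν : ProbabilityMeasure ℝ) : 0 ≤ levyDist μ ν :=
  Real.sInf_nonneg fun _ h => h.1.le

theorem levyDist_triangle (μ ν ρ : ProbabilityMeasure ℝ) :
    levyDist μ ρ ≤ levyDist μ ν + levyDist ν ρ := by
  refine le_of_forall_pos_le_add fun δ hδ => ?_
  set a := levyDist μ ν + δ / 2 with ha
  set b := levyDist ν ρ + δ / 2 with hb
  have h1 := of_levyDist_lt (show levyDist μ ν < a by linarith)
  have h2 := of_levyDist_lt (show levyDist ν ρ < b by linarith)
  have hab : levyDist μ ν + levyDist ν ρ + δ = a + b := by rw [ha, hb]; ring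
  rw [hab]
  have := levyDist_nonneg μ ν
  have := levyDist_nonneg ν ρ
  refine levyDist_le (by linarith) fun t => ⟨?_, ?_⟩
  · have e : t - (a + b) = t - b - a := by ring
    rw [e]
    linarith [(h1 (t - b)).1, (h2 t).1]
  · have e : t + (a + b) = t + b + a := by ring
    rw [e]
    linarith [(h1 (t + b)).2, (h2 t).2]

theorem cdf_le_of_forall_add_le {μ ν : Measure ℝ} {t : ℝ}
    (h : ∀ ε : ℝ, 0 < ε → cdf μ t - ε ≤ cdf ν (t + ε)) : cdf μ t ≤ cdf ν t := by
  have h1 : Tendsto (cdf ν) (𝓝[>] t) (𝓝 (cdf ν t)) :=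
    ((cdf ν).right_continuous t).mono_left (nhdsWithin_mono t Ioi_subset_Ici_self)
  have h2 : Tendsto (fun s : ℝ => cdf μ t - (s - t)) (𝓝[>] t) (𝓝 (cdf μ t - (t - t))) :=
    (Continuous.tendsto (by fun_prop) t).mono_left nhdsWithin_le_nhds
  rw [sub_self, sub_zero] at h2
  refine le_of_tendsto_of_tendsto h2 h1 ?_
  filter_upwards [self_mem_nhdsWithin] with s hs
  simpa using h (s - t) (sub_pos.mpr hs)

theorem eq_of_levyDist_le_zero {μ ν : ProbabilityMeasure ℝ} (h : levyDist μ ν ≤ 0) : μ = ν := by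
  apply Subtype.ext
  refine Measure.eq_of_cdf (μ : Measure ℝ) (ν : Measure ℝ) (StieltjesFunction.ext fun t => le_antisymm ?_ ?_)
  · refine cdf_le_of_forall_add_le fun ε hε => ?_
    simpa using (of_levyDist_lt (h.trans_lt hε) (t + ε)).1
  · refine cdf_le_of_forall_add_le fun ε hε => ?_
    have := (of_levyDist_lt (h.trans_lt hε) t).2
    linarith

/-- The Poisson integral of a measure on the real line, up to the factor `1 / π`. -/
noncomputable def poissonIntegral (μ : Measure ℝ) (y x : ℝ) : ℝ :=
  ∫ t : ℝ, y / ((x - t) ^ 2 + y ^ 2) ∂μ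

variable {y : ℝ} (μ ν : Measure ℝ) [IsProbabilityMeasure μ] [IsProbabilityMeasure ν]

theorem integrable_prod_poissonKernel (hy : 0 < y) :
    Integrable (fun p : ℝ × ℝ => y / ((p.1 - p.2) ^ 2 + y ^ 2)) (volume.prod μ) := by
  rw [integrable_prod_iff' (by fun_prop : Measurable _).aestronglyMeasurable]
  refine ⟨Eventually.of_forall fun t => integrable_poissonKernel hy t, ?_⟩
  have : ∀ t x : ℝ, ‖y / ((x - t) ^ 2 + y ^ 2)‖ = y / ((x - t) ^ 2 + y ^ 2) := fun t x =>
    Real.norm_of_nonneg (by positivity)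
  simp only [this, integral_poissonKernel hy]
  exact integrable_const _

theorem integrable_poissonIntegral (hy : 0 < y) : Integrable (poissonIntegral μ y) :=
  (integrable_prod_poissonKernel μ hy).integral_prod_left

theorem integral_poissonIntegral (hy : 0 < y) : ∫ x, poissonIntegral μ y x = Real.pi := by
  simp only [poissonIntegral]
  rw [integral_integral_swap (integrable_prod_poissonKernel μ hy)]
  simp [integral_poissonKernel hy]

theorem integral_Iic_poissonIntegral (hy : 0 < y) (s : ℝ) :
    ∫ x in Iic s, poissonIntegral μ y x = ∫ t, (Real.arctan ((s - t) / y) + Real.pi / 2) ∂μ := by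
  simp only [poissonIntegral]
  have h := (integrable_prod_poissonKernel μ hy).restrict (s := Iic s ×ˢ univ)
  rw [← Measure.prod_restrict, Measure.restrict_univ] at h
  rw [integral_integral_swap h]
  simp only [integral_Iic_poissonKernel hy]

theorem arctan_div_ge {ε u : ℝ} (hy : 0 < y) (hε : 0 < ε) (hu : ε ≤ u) :
    Real.pi / 2 - y / ε ≤ Real.arctan (u / y) := by
  have hu0 : 0 < u := hε.trans_le hu
  have h1 := Real.arctan_inv_of_pos (div_pos hy hu0)
  rw [inv_div] at h1
  have h2 : Real.arctan (y / u) ≤ y / u := by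
    have := Real.le_tan (Real.arctan_nonneg.mpr (by positivity : 0 ≤ y / u))
      (Real.arctan_lt_pi_div_two _)
    rwa [Real.tan_arctan] at this
  have h3 : y / u ≤ y / ε := by gcongr
  linarith

/-- The Cauchy law of scale y has mass at most y/(πε) beyond distance ε on either side. The choice y
= πε² makes this ε, so the horizontal and vertical errors in the Lévy distance agree. -/
theorem indicator_sub_le_arctan {ε : ℝ} (hy : 0 < y) (hε : 0 < ε) (he : y = Real.pi * ε ^ 2)
    (s t : ℝ) : (Iic (s - ε)).indicator (fun _ => (1 : ℝ)) t - ε ≤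
      (Real.arctan ((s - t) / y) + Real.pi / 2) / Real.pi ∧
    (Real.arctan ((s - t) / y) + Real.pi / 2) / Real.pi ≤
      (Iic (s + ε)).indicator (fun _ => (1 : ℝ)) t + ε := by
  have hpi := Real.pi_pos
  have hye : y / ε = Real.pi * ε := by rw [he]; field_simp
  have h0 := Real.neg_pi_div_two_lt_arctan ((s - t) / y)
  have h1 := Real.arctan_lt_pi_div_two ((s - t) / y)
  rw [le_div_iff₀ hpi, div_le_iff₀ hpi]
  constructor
  · by_cases ht : t ∈ Iic (s - ε)
    · rw [indicator_of_mem ht]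
      have := arctan_div_ge hy hε (show ε ≤ s - t by linarith [mem_Iic.mp ht])
      rw [hye] at this
      linarith
    · rw [indicator_of_notMem ht]
      nlinarith
  · by_cases ht : t ∈ Iic (s + ε)
    · rw [indicator_of_mem ht]
      nlinarith
    · rw [indicator_of_notMem ht]
      have := arctan_div_ge hy hε (show ε ≤ -(s - t) by linarith [not_le.mp (mem_Iic.not.mp ht)])
      rw [hye, neg_div, Real.arctan_neg] at this
      linarith

theorem cdf_le_integral_poissonIntegral {ε : ℝ} (hy : 0 < y) (hε : 0 < ε)
    (he : y = Real.pi * ε ^ 2) (s : ℝ) :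
    cdf μ (s - ε) - ε ≤ (∫ x in Iic s, poissonIntegral μ y x) / Real.pi ∧
      (∫ x in Iic s, poissonIntegral μ y x) / Real.pi ≤ cdf μ (s + ε) + ε := by
  rw [integral_Iic_poissonIntegral μ hy, ← integral_div]
  have hi : Integrable (fun t => (Real.arctan ((s - t) / y) + Real.pi / 2) / Real.pi) μ := by
    refine (integrable_const (1 : ℝ)).mono'
      (by fun_prop : Measurable _).aestronglyMeasurable (Eventually.of_forall fun t => ?_)
    have h0 := Real.neg_pi_div_two_lt_arctan ((s - t) / y)
    have h1 := Real.arctan_lt_pi_div_two ((s - t) / y)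
    have hpi := Real.pi_pos
    rw [Real.norm_of_nonneg (div_nonneg (by linarith) hpi.le), div_le_one hpi]
    linarith
  have hind : ∀ a : ℝ, Integrable ((Iic a).indicator fun _ => (1 : ℝ)) μ := fun a =>
    (integrable_const _).indicator measurableSet_Iic
  have e : ∀ a : ℝ, ∫ t, (Iic a).indicator (fun _ => (1 : ℝ)) t ∂μ = cdf μ a := fun a => by
    rw [integral_indicator_const _ measurableSet_Iic, smul_eq_mul, mul_one, cdf_eq_real]
  constructor
  · have := integral_mono ((hind (s - ε)).sub (integrable_const ε)) hi
      fun t => (indicator_sub_le_arctan hy hε he s t).1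
    simp only [Pi.sub_apply] at this
    rwa [integral_sub (hind _) (integrable_const _), e, integral_const, probReal_univ,
      one_smul] at this
  · have := integral_mono hi ((hind (s + ε)).add (integrable_const ε))
      fun t => (indicator_sub_le_arctan hy hε he s t).2
    simp only [Pi.add_apply] at this
    rwa [integral_add (hind _) (integrable_const _), e, integral_const, probReal_univ,
      one_smul] at this

/-- The Lévy distance is controlled by the `L¹`-distance of Poisson integrals. -/
theorem levyDist_le_of_poissonIntegral (μ ν : ProbabilityMeasure ℝ) {y K : ℝ} (hy : 0 < y)
    (hK : ∫ x, |poissonIntegral (μ : Measure ℝ) y x - poissonIntegral (ν : Measure ℝ) y x| ≤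
      Real.pi * K) :
    levyDist μ ν ≤ 2 * √(y / Real.pi) + K := by
  have hpi := Real.pi_pos
  set ε := √(y / Real.pi)
  have hε : 0 < ε := Real.sqrt_pos.mpr (by positivity)
  have he : y = Real.pi * ε ^ 2 := by
    rw [Real.sq_sqrt (by positivity)]
    field_simp
  have hK0 : 0 ≤ K := by
    have := (integral_nonneg fun x => abs_nonneg _).trans hK
    exact nonneg_of_mul_nonneg_right this hpi
  have hiμ := integrable_poissonIntegral (μ : Measure ℝ) hy
  have hiν := integrable_poissonIntegral (ν : Measure ℝ) hy
  have hdiff : ∀ s : ℝ, |(∫ x in Iic s, poissonIntegral (μ : Measure ℝ) y x) / Real.pi -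
      (∫ x in Iic s, poissonIntegral (ν : Measure ℝ) y x) / Real.pi| ≤ K := by
    intro s
    rw [← sub_div, ← integral_sub hiμ.integrableOn hiν.integrableOn, abs_div, abs_of_pos hpi,
      div_le_iff₀ hpi, mul_comm]
    refine (abs_integral_le_integral_abs.trans ?_).trans hK
    exact setIntegral_le_integral (hiμ.sub hiν).abs (Eventually.of_forall fun x => abs_nonneg _)
  have hμ := cdf_le_integral_poissonIntegral (μ : Measure ℝ) hy hε he
  have hν := cdf_le_integral_poissonIntegral (ν : Measure ℝ) hy hε he
  -- Each measure is compared with its smoothing at cost ε, and the smoothed distribution functions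
  -- differ by at most K.
  refine levyDist_le (by positivity) fun t => ⟨?_, ?_⟩
  · have h1 := monotone_cdf (μ : Measure ℝ) (show t - (2 * ε + K) ≤ t - ε - ε by linarith)
    have h2 := (hν (t - ε)).2
    rw [sub_add_cancel] at h2
    linarith [(hμ (t - ε)).1, (abs_le.mp (hdiff (t - ε))).2]
  · have h1 := monotone_cdf (μ : Measure ℝ) (show t + ε + ε ≤ t + (2 * ε + K) by linarith)
    have h2 := (hν (t + ε)).1
    rw [add_sub_cancel_right] at h2
    linarith [(hμ (t + ε)).2, (abs_le.mp (hdiff (t + ε))).1]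

end Levy

/-! ### Bounds, asymptotics and holomorphy of z ↦ G(z1 − b₀). -/

section DysonResolvent

open Filter Topology MeasureTheory Set

variable {B : Type*} [CStarAlgebra B] [PartialOrder B]

/-- The solution of the Dyson equation at the points `z 1 - b₀`. -/
noncomputable def dysonResolvent (η : B →L[ℂ] B) (b₀ : selfAdjoint B) (z : UpperHalfPlane) : B :=
  (dysonSolution η ⟨(z : ℂ) • (1 : B) - (b₀ : B), smul_one_sub_mem_upperHalf z b₀⟩ : B)

omit [PartialOrder B] in
theorem imaginaryPart_smul_one_sub (z : ℂ) (b₀ : selfAdjoint B) :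
    (ℑ (z • (1 : B) - (b₀ : B)) : B) = z.im • (1 : B) := by
  have h : ℑ (b₀ : B) = 0 := b₀.2.imaginaryPart
  have h1 : ℜ (1 : B) = (1 : selfAdjoint B) := by ext; simp
  have h2 : ℑ (1 : B) = 0 := (IsSelfAdjoint.one B).imaginaryPart
  rw [map_sub, h, imaginaryPart_smul, h2, h1]
  simp

variable [StarOrderedRing B] {η : B →L[ℂ] B}

theorem dysonResolvent_eq (hη : η ∈ kPositiveMaps B 2) (b₀ : selfAdjoint B) (z : UpperHalfPlane) :
    dysonResolvent η b₀ z =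
      Ring.inverse ((z : ℂ) • (1 : B) - (b₀ : B) - η (dysonResolvent η b₀ z)) :=
  dysonSolution_eq_inverse hη _

theorem neg_imaginaryPart_dysonResolvent_nonneg (b₀ : selfAdjoint B) (z : UpperHalfPlane) :
    0 ≤ -(ℑ (dysonResolvent η b₀ z) : B) :=
  neg_imaginaryPart_nonneg_of_mem_lowerHalf (Subtype.property _)

theorem le_imaginaryPart_dysonResolvent (hη : η ∈ kPositiveMaps B 2) (b₀ : selfAdjoint B)
    (z : UpperHalfPlane) : z.im • (1 : B) ≤
      (ℑ ((z : ℂ) • (1 : B) - (b₀ : B) - η (dysonResolvent η b₀ z)) : B) :=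
  le_imaginaryPart_sub hη (imaginaryPart_smul_one_sub z b₀).ge
    (neg_imaginaryPart_dysonResolvent_nonneg b₀ z)

theorem norm_dysonResolvent_le (hη : η ∈ kPositiveMaps B 2) (b₀ : selfAdjoint B)
    (z : UpperHalfPlane) : ‖dysonResolvent η b₀ z‖ ≤ 1 / z.im := by
  rw [dysonResolvent_eq hη]
  exact norm_inverse_le z.im_pos (le_imaginaryPart_dysonResolvent hη b₀ z)

/-- The Dyson equation reads zG − 1 = (b₀ + η(G))G. This first bounds ‖zG‖, and inserting that bound
gives decay of order 1/|z|. -/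
theorem norm_smul_dysonResolvent_sub_one_le (hη : η ∈ kPositiveMaps B 2) (b₀ : selfAdjoint B)
    {y : ℝ} (hy : 0 < y) {z : UpperHalfPlane} (hz : y ≤ z.im) :
    ‖(z : ℂ) • dysonResolvent η b₀ z - 1‖ ≤
      (‖b₀‖ + ‖η‖ / y) * (‖(1 : B)‖ + (‖b₀‖ + ‖η‖ / y) / y) / ‖(z : ℂ)‖ := by
  set G := dysonResolvent η b₀ z
  set R := ‖b₀‖ + ‖η‖ / y
  have hG : ‖G‖ ≤ 1 / y :=
    (norm_dysonResolvent_le hη b₀ z).trans (one_div_le_one_div_of_le hy hz)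
  have hz0 : 0 < ‖(z : ℂ)‖ := norm_pos_iff.mpr z.ne_zero
  have hR : ‖(b₀ : B) + η G‖ ≤ R := by
    refine (norm_add_le _ _).trans (add_le_add le_rfl ?_)
    exact (η.le_opNorm_of_le hG).trans_eq (mul_one_div _ _)
  have hR0 : 0 ≤ R := (norm_nonneg _).trans hR
  have hu := isUnit_of_le_imaginaryPart z.im_pos (le_imaginaryPart_dysonResolvent hη b₀ z)
  have e : (z : ℂ) • G - 1 = ((b₀ : B) + η G) * G := by
    have h1 := Ring.mul_inverse_cancel _ hu
    rw [← dysonResolvent_eq hη] at h1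
    have h2 : (z : ℂ) • G - (b₀ : B) * G - η G * G = 1 := by
      rw [← h1, sub_mul, sub_mul, smul_mul_assoc, one_mul]
    rw [← h2, add_mul]
    abel
  have h3 : ‖(z : ℂ)‖ * ‖G‖ ≤ ‖(1 : B)‖ + R / y := by
    rw [← norm_smul]
    calc ‖(z : ℂ) • G‖ = ‖1 + ((b₀ : B) + η G) * G‖ := by rw [← e]; congr 1; abel
      _ ≤ ‖(1 : B)‖ + R * (1 / y) := (norm_add_le _ _).trans (add_le_add le_rfl
          ((norm_mul_le _ _).trans (mul_le_mul hR hG (norm_nonneg _) hR0)))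
      _ = _ := by rw [mul_one_div]
  rw [e, le_div_iff₀ hz0]
  calc ‖((b₀ : B) + η G) * G‖ * ‖(z : ℂ)‖ ≤ R * ‖G‖ * ‖(z : ℂ)‖ := by
        gcongr
        exact (norm_mul_le _ _).trans (by gcongr)
    _ = R * (‖(z : ℂ)‖ * ‖G‖) := by ring
    _ ≤ _ := by gcongr

theorem differentiableAt_dysonIterate (hη : η ∈ kPositiveMaps B 2) (b₀ : selfAdjoint B)
    {z : ℂ} (hz : 0 < z.im) (k : ℕ) :
    DifferentiableAt ℂ (fun z : ℂ => dysonIterate η (z • (1 : B) - (b₀ : B)) k) z := by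
  induction k with
  | zero => simp [dysonIterate]
  | succ k ih =>
    simp only [dysonIterate_succ]
    have hb := (imaginaryPart_smul_one_sub z b₀).ge
    have hu := isUnit_of_le_imaginaryPart hz
      (le_imaginaryPart_sub hη hb (dysonIterate_bounds hη hz hb k).1)
    have h1 : DifferentiableAt ℂ (fun z : ℂ => z • (1 : B) - (b₀ : B) -
        η (dysonIterate η (z • (1 : B) - (b₀ : B)) k)) z :=
      (((differentiableAt_id.smul_const (1 : B)).sub_const (b₀ : B))).sub
        (η.differentiableAt.comp z ih)
    exact DifferentiableAt.comp (g := Ring.inverse) z (differentiableAt_inverse hu) h1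

theorem differentiableOn_dysonResolvent (hη : η ∈ kPositiveMaps B 2) (b₀ : selfAdjoint B) :
    DifferentiableOn ℂ (fun z : ℂ => dysonResolvent η b₀ (UpperHalfPlane.ofComplex z))
      {z : ℂ | 0 < z.im} := by
  have ho : IsOpen {z : ℂ | 0 < z.im} := isOpen_lt continuous_const Complex.continuous_im
  refine TendstoLocallyUniformlyOn.differentiableOn (φ := atTop)
    (F := fun (k : ℕ) (z : ℂ) => dysonIterate η (z • (1 : B) - (b₀ : B)) k) ?_
    (Eventually.of_forall fun k z hz =>
      (differentiableAt_dysonIterate hη b₀ hz k).differentiableWithinAt) ho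
  rw [Metric.tendstoLocallyUniformlyOn_iff]
  intro ε hε x hx
  have hx2 : 0 < x.im / 2 := half_pos hx
  -- These bounds hold uniformly for z in the unit ball around x with Im z > (Im x)/2, which gives
  -- locally uniform convergence.
  obtain ⟨C, θ, hθ, hθ0, hC⟩ := exists_dysonIterate_geometric hη hx2
    ((‖x‖ + 1) * ‖(1 : B)‖ + ‖(b₀ : B)‖)
  refine ⟨{z : ℂ | x.im / 2 < z.im} ∩ Metric.ball x 1, mem_nhdsWithin_of_mem_nhds
    (inter_mem ((isOpen_lt continuous_const Complex.continuous_im).mem_nhds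
      (show x.im / 2 < x.im from half_lt_self hx)) (Metric.ball_mem_nhds x one_pos)), ?_⟩
  have hlim : Tendsto (fun k : ℕ => C * θ ^ k / (1 - θ)) atTop (𝓝 (C * 0 / (1 - θ))) :=
    ((tendsto_pow_atTop_nhds_zero_of_lt_one hθ0 hθ).const_mul C).div_const _
  rw [mul_zero, zero_div] at hlim
  filter_upwards [hlim.eventually (gt_mem_nhds hε)] with k hk z hz
  have hzim : 0 < z.im := hx2.trans hz.1
  have hzx : ‖z‖ ≤ ‖x‖ + 1 := by
    have := (mem_ball_iff_norm.mp hz.2).le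
    have h2 : ‖z‖ ≤ ‖x‖ + ‖z - x‖ := norm_le_norm_add_norm_sub' z x
    linarith
  have hb : (x.im / 2) • (1 : B) ≤ (ℑ (z • (1 : B) - (b₀ : B)) : B) := by
    rw [imaginaryPart_smul_one_sub]
    exact smul_one_mono hz.1.le
  have hn : ‖z • (1 : B) - (b₀ : B)‖ ≤ (‖x‖ + 1) * ‖(1 : B)‖ + ‖(b₀ : B)‖ := by
    refine (norm_sub_le _ _).trans (add_le_add ?_ le_rfl)
    rw [norm_smul]
    gcongr
  have ht : Tendsto (dysonIterate η (z • (1 : B) - (b₀ : B))) atTop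
      (𝓝 (dysonResolvent η b₀ (UpperHalfPlane.ofComplex z))) := by
    have hz' : UpperHalfPlane.ofComplex z = ⟨z, hzim⟩ := UpperHalfPlane.ofComplex_apply_of_im_pos hzim
    rw [hz']
    exact tendsto_dysonIterate hη ⟨_, smul_one_sub_mem_upperHalf ⟨z, hzim⟩ b₀⟩
  rw [dist_comm]
  exact (dist_le_of_le_geometric_of_tendsto θ C hθ (hC _ hb hn) ht k).trans_lt hk

end DysonResolvent

/-! ### The density of states and L¹ comparison of its Poisson integrals. -/

section DensityOfStates

open Filter Topology MeasureTheory Set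

variable {B : Type*} [CStarAlgebra B] [PartialOrder B] [StarOrderedRing B] {η : B →L[ℂ] B}
  (φ : B →ₚ[ℂ] ℂ)

theorem re_map_imaginaryPart (x : B) : (φ (ℑ x : B)).re = (φ x).im := by
  rw [imaginaryPart_apply_coe, ← Complex.coe_smul, map_smul, map_smul, map_sub, map_star]
  simp
  ring

theorem exists_isDensityOfStates (hφ : φ 1 = 1) (hη : η ∈ kPositiveMaps B 2)
    (b₀ : selfAdjoint B) : ∃ μ : ProbabilityMeasure ℝ, IsDensityOfStates φ b₀ η μ := by
  obtain ⟨C, hC⟩ := φ.exists_norm_apply_le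
  let Φ : B →L[ℂ] ℂ := (φ : B →ₗ[ℂ] ℂ).mkContinuous C hC
  have hΦ : ∀ x, Φ x = φ x := fun x => rfl
  have hof : ∀ z : ℂ, 0 < z.im → (UpperHalfPlane.ofComplex z : ℂ) = z := fun z hz => by
    rw [UpperHalfPlane.ofComplex_apply_of_im_pos hz]
  suffices h : ∃ μ : ProbabilityMeasure ℝ, ∀ z : ℂ, 0 < z.im →
      Φ (dysonResolvent η b₀ (UpperHalfPlane.ofComplex z)) =
        ∫ t : ℝ, 1 / (z - (t : ℂ)) ∂(μ : Measure ℝ) by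
    obtain ⟨μ, hμ⟩ := h
    refine ⟨μ, fun z => ?_⟩
    have := hμ z z.im_pos
    rw [UpperHalfPlane.ofComplex_apply] at this
    exact this
  refine exists_measure_of_asymptotic
    (f := fun z => Φ (dysonResolvent η b₀ (UpperHalfPlane.ofComplex z))) ?_ ?_ ?_
  · intro z hz
    have ho : IsOpen {z : ℂ | 0 < z.im} := isOpen_lt continuous_const Complex.continuous_im
    exact Φ.differentiableAt.comp z
      ((differentiableOn_dysonResolvent hη b₀).differentiableAt (ho.mem_nhds hz))
  · intro z hz
    have h := map_nonneg φ
      (neg_imaginaryPart_dysonResolvent_nonneg (η := η) b₀ (UpperHalfPlane.ofComplex z))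
    have h2 := (Complex.le_def.mp h).1
    rw [map_neg, Complex.neg_re, re_map_imaginaryPart, Complex.zero_re] at h2
    rw [hΦ]
    linarith
  · intro y hy
    refine ⟨‖Φ‖ * ((‖b₀‖ + ‖η‖ / y) * (‖(1 : B)‖ + (‖b₀‖ + ‖η‖ / y) / y)), fun z hz => ?_⟩
    have hz0 := hof z (hy.trans_le hz)
    have h1 := norm_smul_dysonResolvent_sub_one_le hη b₀ hy (z := UpperHalfPlane.ofComplex z)
      (by rw [← UpperHalfPlane.coe_im, hz0]; exact hz)
    rw [hz0] at h1
    have h2 : Φ (z • dysonResolvent η b₀ (UpperHalfPlane.ofComplex z) - 1) =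
        z * Φ (dysonResolvent η b₀ (UpperHalfPlane.ofComplex z)) - 1 := by
      rw [map_sub, map_smul, hΦ 1, hφ, smul_eq_mul]
    rw [← h2, mul_div_assoc]
    exact Φ.le_opNorm_of_le h1

omit [StarOrderedRing B] in
theorem IsDensityOfStates.im_eq {b₀ : selfAdjoint B} {μ : ProbabilityMeasure ℝ}
    (h : IsDensityOfStates φ b₀ η μ) (x : ℝ) {y : ℝ} (hy : 0 < y) :
    (φ (dysonResolvent η b₀ ⟨⟨x, y⟩, hy⟩)).im = -poissonIntegral (μ : Measure ℝ) y x := by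
  have := h ⟨⟨x, y⟩, hy⟩
  rw [dysonResolvent, this]
  exact im_integral_one_div_sub (μ : Measure ℝ) x hy

theorem levyDist_le_of_forall {μ ν : ProbabilityMeasure ℝ} {e K : ℝ} (he : 0 < e)
    (hK : ∫ x, |poissonIntegral (μ : Measure ℝ) (Real.pi * e ^ 2) x -
      poissonIntegral (ν : Measure ℝ) (Real.pi * e ^ 2) x| ≤ Real.pi * K) :
    levyDist μ ν ≤ 2 * e + K := by
  have := levyDist_le_of_poissonIntegral μ ν (by positivity) hK
  rwa [mul_div_cancel_left₀ _ Real.pi_ne_zero, Real.sqrt_sq he.le] at this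

/-- Equal Cauchy transforms have equal Poisson integrals at every height, so the smoothing estimate
with K = 0 makes the Lévy distance arbitrarily small. -/
theorem existsUnique_isDensityOfStates (hφ : φ 1 = 1) (hη : η ∈ kPositiveMaps B 2)
    (b₀ : selfAdjoint B) : ∃! μ : ProbabilityMeasure ℝ, IsDensityOfStates φ b₀ η μ := by
  obtain ⟨μ, hμ⟩ := exists_isDensityOfStates φ hφ hη b₀
  refine ⟨μ, hμ, fun ν hν => eq_of_levyDist_le_zero ?_⟩
  refine le_of_forall_pos_le_add fun ε hε => ?_
  have := levyDist_le_of_forall (μ := ν) (ν := μ) (half_pos hε) (K := 0) ?_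
  · linarith
  · have hy : 0 < Real.pi * (ε / 2) ^ 2 := by positivity
    have h0 : ∀ x, poissonIntegral (ν : Measure ℝ) (Real.pi * (ε / 2) ^ 2) x =
        poissonIntegral (μ : Measure ℝ) (Real.pi * (ε / 2) ^ 2) x := fun x => by
      rw [← neg_inj, ← hμ.im_eq φ x hy, ← hν.im_eq φ x hy]
    simp [h0]

theorem isDensityOfStates_densityOfStates (hφ : φ 1 = 1) (hη : η ∈ kPositiveMaps B 2)
    (b₀ : selfAdjoint B) : IsDensityOfStates φ b₀ η (densityOfStates φ b₀ η) :=
  Classical.epsilon_spec (exists_isDensityOfStates φ hφ hη b₀)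

/-- Both Poisson integrals have total mass π, and so has their average. -/
theorem integral_abs_poissonIntegral_sub_le (μ ν : Measure ℝ) [IsProbabilityMeasure μ]
    [IsProbabilityMeasure ν] {y c : ℝ} (hy : 0 < y)
    (h : ∀ x, |poissonIntegral μ y x - poissonIntegral ν y x| ≤
      c * ((poissonIntegral μ y x + poissonIntegral ν y x) / 2)) :
    ∫ x, |poissonIntegral μ y x - poissonIntegral ν y x| ≤ Real.pi * c := by
  have hμ := integrable_poissonIntegral μ hy
  have hν := integrable_poissonIntegral ν hy
  have hs : Integrable fun x => c * ((poissonIntegral μ y x + poissonIntegral ν y x) / 2) :=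
    ((hμ.add hν).div_const 2).const_mul c
  refine (integral_mono (hμ.sub hν).abs hs h).trans_eq ?_
  rw [integral_const_mul, integral_div, integral_add hμ hν, integral_poissonIntegral μ hy,
    integral_poissonIntegral ν hy]
  ring

variable {η₀ η₁ : B →L[ℂ] B}

/-- Dependence of the solution of the Dyson equation on its data. -/
theorem posBlock_dysonResolvent_sub (h₁ : η₁ ∈ kPositiveMaps B 2) (h₀ : η₀ ∈ kPositiveMaps B 2)
    (b₁ b₀ : selfAdjoint B) (z : UpperHalfPlane) {δ c : ℝ} (hδ : ‖η₁ - η₀‖ ≤ δ)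
    (hy : δ / z.im < z.im) (hc : (‖b₁ - b₀‖ + δ / z.im) / (z.im - δ / z.im) < c) :
    PosBlock (c • -(ℑ (dysonResolvent η₁ b₁ z) : B))
      (dysonResolvent η₁ b₁ z - dysonResolvent η₀ b₀ z)
      (c • -(ℑ (dysonResolvent η₀ b₀ z) : B)) := by
  have hz := z.im_pos
  have hδ0 : 0 ≤ δ := (norm_nonneg _).trans hδ
  have e₁ := dysonResolvent_eq h₁ b₁ z
  have e₀ := dysonResolvent_eq h₀ b₀ z
  have n₀ := norm_dysonResolvent_le h₀ b₀ z
  have p₁ := le_imaginaryPart_dysonResolvent h₁ b₁ z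
  have p₀ := le_imaginaryPart_dysonResolvent h₀ b₀ z
  have q₀ := neg_imaginaryPart_dysonResolvent_nonneg (η := η₀) b₀ z
  set G₁ := dysonResolvent η₁ b₁ z
  set G₀ := dysonResolvent η₀ b₀ z
  have hκ : 0 < z.im - δ / z.im := sub_pos.mpr hy
  have hκz : z.im - δ / z.im ≤ z.im := sub_le_self _ (by positivity)
  have hdiff : ∀ x : B, ‖x‖ ≤ 1 / z.im → ‖(η₁ - η₀) x‖ ≤ δ / z.im := fun x hx =>
    ((η₁ - η₀).le_of_opNorm_le_of_le hδ hx).trans_eq (mul_one_div _ _)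
  -- Both fixed points are read with the single map η₁. The discrepancy (η₁ − η₀)(G₀), of norm at
  -- most δ/Im z, joins the perturbation h, and (η₁ − η₀)(−Im G₀) lowers the margin κ from Im z to
  -- Im z − δ/Im z.
  have key := fun c => posBlock_sub_of_fixedPoint (c := c) h₁
    (h := ((b₁ - b₀ : selfAdjoint B) : B) + (η₁ - η₀) G₀) (s := ‖b₁ - b₀‖ + δ / z.im)
    (d₁ := (z : ℂ) • (1 : B) - (b₁ : B) - η₁ G₁) (d₀ := (z : ℂ) • (1 : B) - (b₀ : B) - η₀ G₀)
    hκ ((norm_add_le _ _).trans (add_le_add le_rfl (hdiff G₀ n₀)))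
    (by
      rw [← e₁, ← e₀, map_sub, sub_apply, AddSubgroupClass.coe_sub]
      abel)
    ((smul_one_mono hκz).trans p₁) ((smul_one_mono hκz).trans p₀)
    (by
      rw [← e₁]
      exact (add_le_add_right (smul_one_mono hκz) _).trans
        (map_add_le_imaginaryPart_sub h₁ (imaginaryPart_smul_one_sub z b₁).ge))
    (by
      rw [← e₀]
      have h2 : (η₁ - η₀) (-(ℑ G₀ : B)) ≤ (δ / z.im) • (1 : B) := by
        have hsa : IsSelfAdjoint ((η₁ - η₀) (-(ℑ G₀ : B))) := by
          rw [sub_apply]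
          exact (h₁.1 _ q₀).isSelfAdjoint.sub (h₀.1 _ q₀).isSelfAdjoint
        refine hsa.le_algebraMap_norm_self.trans ?_
        rw [Algebra.algebraMap_eq_smul_one]
        refine smul_one_mono (hdiff _ ?_)
        rw [norm_neg]
        exact (imaginaryPart.norm_le G₀).trans n₀
      have h3 := map_add_le_imaginaryPart_sub (w := G₀) h₀ (imaginaryPart_smul_one_sub z b₀).ge
      have h4 := add_le_add h2 h3
      rw [← sub_nonneg] at h4 ⊢
      refine h4.trans_eq ?_
      rw [sub_apply, sub_smul]
      simp only [UpperHalfPlane.coe_im]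
      abel)
  simp only [← e₁, ← e₀] at key
  exact key c hc

theorem integral_abs_poissonIntegral_densityOfStates_sub_le (hφ : φ 1 = 1)
    (h₁ : η₁ ∈ kPositiveMaps B 2) (h₀ : η₀ ∈ kPositiveMaps B 2) (b₁ b₀ : selfAdjoint B)
    {δ c y : ℝ} (hδ : ‖η₁ - η₀‖ ≤ δ) (hy0 : 0 < y) (hy : δ / y < y)
    (hc : (‖b₁ - b₀‖ + δ / y) / (y - δ / y) < c) :
    ∫ x, |poissonIntegral (densityOfStates φ b₁ η₁ : Measure ℝ) y x -
      poissonIntegral (densityOfStates φ b₀ η₀ : Measure ℝ) y x| ≤ Real.pi * c := by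
  refine integral_abs_poissonIntegral_sub_le _ _ hy0 fun x => ?_
  have e₁ := (isDensityOfStates_densityOfStates φ hφ h₁ b₁).im_eq φ x hy0
  have e₀ := (isDensityOfStates_densityOfStates φ hφ h₀ b₀).im_eq φ x hy0
  have key := (posBlock_dysonResolvent_sub h₁ h₀ b₁ b₀ ⟨⟨x, y⟩, hy0⟩ hδ hy hc).norm_apply_le φ
  have hre : ∀ a : B, (φ (c • -(ℑ a : B))).re = c * -(φ a).im := fun a => by
    rw [← Complex.coe_smul, map_smul, map_neg, smul_eq_mul, Complex.re_ofReal_mul, Complex.neg_re,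
      re_map_imaginaryPart]
  rw [hre, hre, e₁, e₀, neg_neg, neg_neg] at key
  have h2 := (Complex.abs_im_le_norm _).trans key
  rw [map_sub, Complex.sub_im, e₁, e₀, neg_sub_neg, abs_sub_comm] at h2
  exact h2.trans_eq (by ring)

end DensityOfStates

/-! ### The Hölder estimates and their constants. -/

section Holder

open Filter Topology MeasureTheory Set

variable {B : Type*} [CStarAlgebra B] [PartialOrder B] [StarOrderedRing B]
  (φ : B →ₚ[ℂ] ℂ) {η η₀ η₁ : B →L[ℂ] B}

theorem levyDist_densityOfStates_offset_le (hφ : φ 1 = 1) (hη : η ∈ kPositiveMaps B 2)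
    (b₁ b₀ : selfAdjoint B) {e : ℝ} (he : 0 < e) :
    levyDist (densityOfStates φ b₁ η) (densityOfStates φ b₀ η) ≤
      2 * e + ‖b₁ - b₀‖ / (Real.pi * e ^ 2) := by
  refine le_of_forall_pos_le_add fun ε hε => ?_
  have hy : 0 < Real.pi * e ^ 2 := by positivity
  rw [add_assoc]
  refine levyDist_le_of_forall he ?_
  refine integral_abs_poissonIntegral_densityOfStates_sub_le φ hφ hη hη b₁ b₀ (δ := 0)
    (by simp) hy (by simpa using hy) ?_
  rw [zero_div, add_zero, sub_zero]
  exact lt_add_of_pos_right _ hε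

/-- A Lipschitz estimate along a segment of `2`-positive maps follows from its infinitesimal
version. -/
theorem integral_abs_poissonIntegral_map_sub_le (hφ : φ 1 = 1) (h₁ : η₁ ∈ kPositiveMaps B 2)
    (h₀ : η₀ ∈ kPositiveMaps B 2) (b : selfAdjoint B) {y K : ℝ} (hy : 0 < y)
    (hK : ‖η₁ - η₀‖ / y ^ 2 < K) :
    ∫ x, |poissonIntegral (densityOfStates φ b η₁ : Measure ℝ) y x -
      poissonIntegral (densityOfStates φ b η₀ : Measure ℝ) y x| ≤ Real.pi * K := by
  set δ := ‖η₁ - η₀‖ with hδ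
  have hδ0 : 0 ≤ δ := norm_nonneg _
  -- A subsegment of length δ/n costs (δ/(ny))/(y − δ/(ny)). The n costs add up to a quantity
  -- tending to δ/y² < K, so the loss in the margin disappears for large n.
  obtain ⟨n, hn, hn1, hn2⟩ : ∃ n : ℕ, 0 < n ∧ δ / n / y < y ∧
      (δ / y) / (y - δ / n / y) < K := by
    have hlim : Tendsto (fun n : ℕ => δ / n / y) atTop (𝓝 0) := by
      simpa using (tendsto_const_div_atTop_nhds_zero_nat δ).div_const y
    have hlim2 : Tendsto (fun n : ℕ => (δ / y) / (y - δ / n / y)) atTop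
        (𝓝 ((δ / y) / (y - 0))) :=
      tendsto_const_nhds.div (hlim.const_sub y) (by simpa using hy.ne')
    have e : (δ / y) / (y - 0) = δ / y ^ 2 := by
      rw [sub_zero, div_div, sq]
    rw [e] at hlim2
    exact ((eventually_gt_atTop 0).and ((hlim.eventually (gt_mem_nhds hy)).and
      (hlim2.eventually (gt_mem_nhds hK)))).exists
  have hn0 : (0 : ℝ) < n := Nat.cast_pos.mpr hn
  set ξ : ℕ → B →L[ℂ] B := fun k => AffineMap.lineMap η₀ η₁ ((k : ℝ) / n)
  have hξ : ∀ k ≤ n, ξ k ∈ kPositiveMaps B 2 := fun k hk =>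
    convex_kPositiveMaps.lineMap_mem h₀ h₁
      ⟨by positivity, (div_le_one hn0).mpr (Nat.cast_le.mpr hk)⟩
  have hstep : ∀ k, ‖ξ (k + 1) - ξ k‖ ≤ δ / n := by
    intro k
    have : ξ (k + 1) - ξ k = (1 / n : ℝ) • (η₁ - η₀) := by
      simp only [ξ, AffineMap.lineMap_apply_module']
      rw [add_sub_add_right_eq_sub, ← sub_smul]
      congr 1
      push_cast
      field_simp
      ring
    rw [this, norm_smul, Real.norm_of_nonneg (by positivity), ← hδ, one_div_mul_eq_div]
  set P : ℕ → ℝ → ℝ := fun k => poissonIntegral (densityOfStates φ b (ξ k) : Measure ℝ) y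
  have hP : ∀ k, Integrable (P k) := fun k => integrable_poissonIntegral _ hy
  have hPd : ∀ j k, Integrable fun x => |P j x - P k x| := fun j k => ((hP j).sub (hP k)).abs
  have key : ∀ k ≤ n, ∫ x, |P k x - P 0 x| ≤ k * (Real.pi * (K / n)) := by
    intro k
    induction k with
    | zero => intro _; simp
    | succ k ih =>
      intro hk
      have h1 := ih (by omega)
      have h2 : ∫ x, |P (k + 1) x - P k x| ≤ Real.pi * (K / n) := by
        refine integral_abs_poissonIntegral_densityOfStates_sub_le φ hφ (hξ _ hk)
          (hξ k (by omega)) b b (hstep k) hy hn1 ?_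
        rw [sub_self, norm_zero, zero_add]
        have : δ / n / y / (y - δ / n / y) = (δ / y) / (y - δ / n / y) / n := by
          rw [div_right_comm δ, div_right_comm (δ / y)]
        rw [this]
        gcongr
      have h3 : ∫ x, |P (k + 1) x - P 0 x| ≤
          ∫ x, (|P (k + 1) x - P k x| + |P k x - P 0 x|) :=
        integral_mono (hPd _ _) ((hPd _ _).add (hPd _ _)) fun x => abs_sub_le _ _ _
      rw [integral_add (hPd _ _) (hPd _ _)] at h3
      push_cast
      linarith
  have hfin := key n le_rfl
  have e1 : ξ n = η₁ := by simp [ξ, hn0.ne']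
  have e0 : ξ 0 = η₀ := by simp [ξ]
  simp only [P, e1, e0] at hfin
  refine hfin.trans_eq ?_
  field_simp

theorem levyDist_densityOfStates_map_le (hφ : φ 1 = 1) (h₁ : η₁ ∈ kPositiveMaps B 2)
    (h₀ : η₀ ∈ kPositiveMaps B 2) (b : selfAdjoint B) {e : ℝ} (he : 0 < e) :
    levyDist (densityOfStates φ b η₁) (densityOfStates φ b η₀) ≤
      2 * e + ‖η₁ - η₀‖ / (Real.pi * e ^ 2) ^ 2 := by
  refine le_of_forall_pos_le_add fun ε hε => ?_
  rw [add_assoc]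
  exact levyDist_le_of_forall he (integral_abs_poissonIntegral_map_sub_le φ hφ h₁ h₀ b
    (by positivity) (lt_add_of_pos_right _ hε))

/-- The right side is minimal at e³ = δ/π, where both terms are multiples of e and sum to 3e. For δ
= 0 that point is not positive, so e is sent to 0 instead. -/
theorem le_rpow_one_third {L δ : ℝ} (hδ : 0 ≤ δ)
    (h : ∀ e : ℝ, 0 < e → L ≤ 2 * e + δ / (Real.pi * e ^ 2)) :
    L ≤ 3 * (1 / Real.pi) ^ (1 / 3 : ℝ) * δ ^ (1 / 3 : ℝ) := by
  have hpi := Real.pi_pos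
  rcases hδ.eq_or_lt with rfl | hδ
  · rw [Real.zero_rpow (by norm_num), mul_zero]
    refine le_of_forall_pos_le_add fun ε hε => ?_
    have := h (ε / 2) (half_pos hε)
    rw [zero_div] at this
    linarith
  · set e : ℝ := (1 / Real.pi) ^ (1 / 3 : ℝ) * δ ^ (1 / 3 : ℝ)
    have he : 0 < e := by positivity
    have he3 : e ^ 3 = δ / Real.pi := by
      rw [mul_pow, ← Real.rpow_natCast, ← Real.rpow_natCast, ← Real.rpow_mul (by positivity),
        ← Real.rpow_mul hδ.le]
      norm_num
      field_simp
    have h1 : δ / (Real.pi * e ^ 2) = e := by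
      rw [div_eq_iff (by positivity)]
      have : δ = Real.pi * e ^ 3 := by rw [he3]; field_simp
      rw [this]; ring
    have := h e he
    rw [h1] at this
    rw [mul_assoc]
    linarith

/-- The minimum is at e = 2r with r⁵ = δ/(4π)², where the second term equals r and the sum is 5r. -/
theorem le_rpow_one_fifth {L δ : ℝ} (hδ : 0 ≤ δ)
    (h : ∀ e : ℝ, 0 < e → L ≤ 2 * e + δ / (Real.pi * e ^ 2) ^ 2) :
    L ≤ 5 * (1 / (4 * Real.pi)) ^ (2 / 5 : ℝ) * δ ^ (1 / 5 : ℝ) := by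
  have hpi := Real.pi_pos
  rcases hδ.eq_or_lt with rfl | hδ
  · rw [Real.zero_rpow (by norm_num), mul_zero]
    refine le_of_forall_pos_le_add fun ε hε => ?_
    have := h (ε / 2) (half_pos hε)
    rw [zero_div] at this
    linarith
  · set r : ℝ := (1 / (4 * Real.pi)) ^ (2 / 5 : ℝ) * δ ^ (1 / 5 : ℝ)
    have hr : 0 < r := by positivity
    have hr5 : r ^ 5 = δ / (4 * Real.pi) ^ 2 := by
      rw [mul_pow, ← Real.rpow_natCast, ← Real.rpow_natCast, ← Real.rpow_mul (by positivity),
        ← Real.rpow_mul hδ.le]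
      norm_num
      field_simp
    have h1 : δ / (Real.pi * (2 * r) ^ 2) ^ 2 = r := by
      rw [div_eq_iff (by positivity)]
      have : δ = (4 * Real.pi) ^ 2 * r ^ 5 := by rw [hr5]; field_simp
      rw [this]; ring
    have := h (2 * r) (by positivity)
    rw [h1] at this
    rw [mul_assoc]
    linarith

theorem three_mul_rpow_lt : 3 * (1 / Real.pi) ^ (1 / 3 : ℝ) < 2.0484 := by
  have hpi := Real.pi_gt_d4
  have h0 : 0 < Real.pi := Real.pi_pos
  refine lt_of_pow_lt_pow_left₀ 3 (by norm_num) ?_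
  rw [mul_pow, ← Real.rpow_natCast ((1 / Real.pi) ^ (1 / 3 : ℝ)), ← Real.rpow_mul (by positivity)]
  norm_num
  rw [← div_eq_mul_inv, div_lt_iff₀ h0]
  norm_num at hpi ⊢
  linarith

theorem five_mul_rpow_lt : 5 * (1 / (4 * Real.pi)) ^ (2 / 5 : ℝ) < 1.8168 := by
  have hpi := Real.pi_gt_d4
  have h0 : 0 < Real.pi := Real.pi_pos
  refine lt_of_pow_lt_pow_left₀ 5 (by norm_num) ?_
  have e : ((1 / (4 * Real.pi)) ^ (2 / 5 : ℝ)) ^ 5 = 1 / (4 * Real.pi) ^ 2 := by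
    rw [← Real.rpow_natCast, ← Real.rpow_mul (by positivity)]
    norm_num
    ring
  rw [mul_pow, e, mul_one_div, div_lt_iff₀ (by positivity)]
  norm_num at hpi ⊢
  nlinarith

theorem exists_mul_rpow_lt (c : ℝ) {p ε : ℝ} (hp : 0 < p) (hε : 0 < ε) :
    ∃ δ > 0, ∀ r, 0 ≤ r → r < δ → c * r ^ p < ε := by
  have h : Tendsto (fun r : ℝ => c * r ^ p) (𝓝 0) (𝓝 (c * 0 ^ p)) :=
    ((Real.continuousAt_rpow_const 0 p (Or.inr hp.le)).tendsto).const_mul c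
  rw [Real.zero_rpow hp.ne', mul_zero] at h
  obtain ⟨δ, hδ, hb⟩ := Metric.eventually_nhds_iff.mp (h.eventually (gt_mem_nhds hε))
  exact ⟨δ, hδ, fun r h0 hr => hb (by rwa [Real.dist_0_eq_abs, abs_of_nonneg h0])⟩

end Holder

end DysonDensity

theorem theorem1p1 {B : Type*} [CStarAlgebra B] [PartialOrder B] [StarOrderedRing B]
    (φ : B →ₚ[ℂ] ℂ) (hφ : φ 1 = 1) :
    -- the map `(b₀, η) ↦ μ_(b₀, η)` is well defined
    (∀ η ∈ DysonDensity.kPositiveMaps B 2,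
      (∃! G : DysonDensity.upperHalf B → DysonDensity.lowerHalf B,
        DysonDensity.IsDysonSolution η G) ∧
      ∀ b₀ : selfAdjoint B, ∃! μ : MeasureTheory.ProbabilityMeasure ℝ,
        DysonDensity.IsDensityOfStates φ b₀ η μ) ∧
    -- numerical values of the two constants
    (3 * (1 / Real.pi) ^ (1 / 3 : ℝ) < 2.0484 ∧
      5 * (1 / (4 * Real.pi)) ^ (2 / 5 : ℝ) < 1.8168) ∧
    -- variation of the offset
    (∀ η ∈ DysonDensity.kPositiveMaps B 2, ∀ b₀₀ b₀₁ : selfAdjoint B,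
      DysonDensity.levyDist (DysonDensity.densityOfStates φ b₀₁ η)
          (DysonDensity.densityOfStates φ b₀₀ η) ≤
        3 * (1 / Real.pi) ^ (1 / 3 : ℝ) * ‖b₀₁ - b₀₀‖ ^ (1 / 3 : ℝ)) ∧
    -- variation of the map
    (∀ b₀ : selfAdjoint B,
      ∀ η₀ ∈ DysonDensity.kPositiveMaps B 2, ∀ η₁ ∈ DysonDensity.kPositiveMaps B 2,
      DysonDensity.levyDist (DysonDensity.densityOfStates φ b₀ η₁)
          (DysonDensity.densityOfStates φ b₀ η₀) ≤
        5 * (1 / (4 * Real.pi)) ^ (2 / 5 : ℝ) * ‖η₁ - η₀‖ ^ (1 / 5 : ℝ)) ∧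
    -- uniform continuity
    (∀ d : selfAdjoint B × DysonDensity.kPositiveMaps B 2 →
        selfAdjoint B × DysonDensity.kPositiveMaps B 2 → ℝ,
      DysonDensity.IsProductMetric d →
      ∀ ε > 0, ∃ δ > 0, ∀ ρ₀ ρ₁ : selfAdjoint B × DysonDensity.kPositiveMaps B 2,
        d ρ₁ ρ₀ < δ →
          DysonDensity.levyDist (DysonDensity.densityOfStates φ ρ₁.1 ρ₁.2)
            (DysonDensity.densityOfStates φ ρ₀.1 ρ₀.2) < ε) := by
  refine ⟨fun η hη => ⟨DysonDensity.existsUnique_isDysonSolution hη,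
      DysonDensity.existsUnique_isDensityOfStates φ hφ hη⟩,
    ⟨DysonDensity.three_mul_rpow_lt, DysonDensity.five_mul_rpow_lt⟩, ?_, ?_, ?_⟩
  · intro η hη b₀₀ b₀₁
    exact DysonDensity.le_rpow_one_third (norm_nonneg _) fun e he =>
      DysonDensity.levyDist_densityOfStates_offset_le φ hφ hη b₀₁ b₀₀ he
  · intro b₀ η₀ h₀ η₁ h₁
    exact DysonDensity.le_rpow_one_fifth (norm_nonneg _) fun e he =>
      DysonDensity.levyDist_densityOfStates_map_le φ hφ h₁ h₀ b₀ he
  · intro d hd ε hε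
    obtain ⟨δ₁, hδ₁, H₁⟩ := DysonDensity.exists_mul_rpow_lt
      (3 * (1 / Real.pi) ^ (1 / 3 : ℝ)) (p := 1 / 3) (by norm_num) (half_pos hε)
    obtain ⟨δ₂, hδ₂, H₂⟩ := DysonDensity.exists_mul_rpow_lt
      (5 * (1 / (4 * Real.pi)) ^ (2 / 5 : ℝ)) (p := 1 / 5) (by norm_num) (half_pos hε)
    obtain ⟨δ, hδ, H⟩ := hd.fst_unif δ₁ hδ₁
    obtain ⟨δ', hδ', H'⟩ := hd.snd_unif δ₂ hδ₂
    refine ⟨min δ δ', lt_min hδ hδ', ?_⟩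
    rintro ⟨b₀, η₀, h₀⟩ ⟨b₁, η₁, h₁⟩ hρ
    have k₁ := H _ _ (hρ.trans_le (min_le_left _ _))
    have k₂ := H' _ _ (hρ.trans_le (min_le_right _ _))
    rw [dist_eq_norm] at k₁
    rw [Subtype.dist_eq, dist_eq_norm] at k₂
    have l₁ := DysonDensity.le_rpow_one_third (norm_nonneg _) fun e he =>
      DysonDensity.levyDist_densityOfStates_offset_le φ hφ h₁ b₁ b₀ he
    have l₂ := DysonDensity.le_rpow_one_fifth (norm_nonneg _) fun e he =>
      DysonDensity.levyDist_densityOfStates_map_le φ hφ h₁ h₀ b₀ he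
    -- The data are changed one coordinate at a time, through the intermediate pair (b₀, η₁).
    have := DysonDensity.levyDist_triangle (DysonDensity.densityOfStates φ b₁ η₁)
      (DysonDensity.densityOfStates φ b₀ η₁) (DysonDensity.densityOfStates φ b₀ η₀)
    have m₁ := H₁ _ (norm_nonneg _) k₁
    have m₂ := H₂ _ (norm_nonneg _) k₂
    linarith
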